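/- **Setting.** An *interval* is a set $[a,b]=\{x\in\mathbb R: a\le x\le b\}$ with $a\in\mathbb R\cup\{-\infty\}$, $b\in\mathbb R\cup\{\infty\}$, $a\le b$; a *box* in $\mathbb R^n$ is a product of $n$ intervals. Intervals $[a_1,b_1],[a_2,b_2]$ are *almost disjoint* if $b_1\le a_2$ or $b_2\le a_1$; boxes are almost disjoint if they are so in some coordinate. For $f:\mathbb R^n\to\mathbb R$ and a box $B$ let $f^{\mathbb I}(B)=[\inf f(B),\sup f(B)]$. *Primitive functions.* Let $\mathcal F$ be a set of measurable functions $f:\mathbb R^n\to\mathbb R$ ($n\ge 0$) that contains all constant functions and is closed under composition: if $f\in\mathcal F$ is $m$-ary and each $g_i$ is in $\mathcal F$ or is the identity of $\mathbb R$, then $(x_1,\dots,x_m)\mapsto f(g_1(x_1),\dots,g_m(x_m))$, with separate tuples of variables $x_i$, is in $\mathcal F$. Assume that every $f\in\mathcal F$ is *boxwise continuous* ($\mathbb R^n$ is a union of countably many pairwise almost disjoint boxes on each of which $f$ is continuous) and *interval separable* (for every interval $J$, the set $f^{-1}(J)$ contains a countable union of boxes whose complement in $f^{-1}(J)$ is Lebesgue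 null). *Programs.* SPCF is the simply typed call-by-value $\lambda$-calculus over a ground type $\mathbf R$ with terms $$M ::= x\mid \underline r\mid \lambda x.M\mid \mu\varphi x.M\mid MN\mid \mathsf{if}(M,N,P)\mid f(M_1,\dots,M_n)\mid\mathsf{sample}\mid\mathsf{score}(M)\qquad (r\in\mathbb R,\ f\in\mathcal F),$$ with values $x,\underline r,\lambda x.M,\mu\varphi x.M$. It is reduced left to right on configurations $(M,s,w)$, where $s$ is a finite sequence in $[0,1]$ (a *trace*) and $w\ge 0$ is a weight: $\lambda$- and fixpoint redexes and primitive functions on literals reduce as usual; $\mathsf{sample}$ removes the first entry $r$ of the trace and becomes $\underline r$; $\mathsf{if}(\underline r,N,P)$ becomes $N$ if $r\le 0$ and $P$ if $r>0$; $\mathsf{score}(\underline r)$, for $r\ge 0$, becomes $\underline r$ and multiplies the weight by $r$. For a closed term $P$ of type $\mathbf R$, if $(P,s,1)\to^*(\underline r,\langle\rangle,w)$, then $s$ is *terminating* and one puts $\mathrm{val}_P(s)=r$, $\mathrm{wt}_P(s)=w$. Let $\mu_{\mathbb T}(U)=\sum_n\lambda_n(U\cap[0,1]^n)$ on $\mathbb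 T=\bigcup_n[0,1]^n$, where $\lambda_n$ is Lebesgue measure, and $$\llbracket P\rrbracket(U)=\int_{\mathrm{val}_P^{-1}(U)}\mathrm{wt}_P\,d\mu_{\mathbb T}\in[0,\infty].$$ $P$ is *almost surely terminating* if $\mu_{\mathbb T}(\mathrm{val}_P^{-1}(\mathbb R))=1$. *Interval semantics.* An *interval trace* is a finite sequence of intervals contained in $[0,1]$. The same reduction is performed with interval literals $\underline{[a,b]}$ in place of the literals ($\underline r$ being read as $\underline{[r,r]}$), interval traces and interval weights: $\mathsf{sample}$ takes the first interval of the trace; $f$ is evaluated by $f^{\mathbb I}$; $\mathsf{if}(\underline{[a,b]},N,P)$ becomes $N$ if $b\le 0$, becomes $P$ if $a>0$, and is stuck otherwise; $\mathsf{score}(\underline{[a,b]})$, for $a\ge 0$, becomes $\underline{[a,b]}$ and multiplies the weight by $[a,b]$ in interval arithmetic. If $(P,t,[1,1])\to_{\mathbb I}^*(\underline I,\langle\rangle,w)$, then $\mathrm{val}^{\mathbb I}_P(t)=I$ and $\mathrm{wt}^{\mathbb I}_P(t)=w$; otherwise $\mathrm{val}^{\mathbb I}_P(t)=[-\infty,\infty]$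 and $\mathrm{wt}^{\mathbb I}_P(t)=[0,\infty]$. Two interval traces are *compatible* if at some position that both possess their entries are almost disjoint; a set of interval traces is compatible if its elements are pairwise compatible. For $t=\langle[a_1,b_1],\dots,[a_n,b_n]\rangle$ let $\mathrm{vol}(t)=\prod_i(b_i-a_i)$, and for a countable compatible set $\mathcal T$ of interval traces let $$\mathrm{lower}_P^{\mathcal T}(U)=\sum_{t\in\mathcal T}\mathrm{vol}(t)\cdot\min\mathrm{wt}^{\mathbb I}_P(t)\cdot[\mathrm{val}^{\mathbb I}_P(t)\subseteq U].$$ *Single use.* In the symbolic execution of $P$, the $i$-th evaluated $\mathsf{sample}$ yields a variable $\alpha_i$; applications of primitive functions to values are left unevaluated and count as values; both branches of each conditional are explored, recording the constraint $\mathcal V\le 0$ or $\mathcal V>0$ on the guard $\mathcal V$; and $\mathsf{score}(\mathcal V)$ records the constraint $\mathcal V\ge 0$ and the score $\mathcal V$ and returns $\mathcal V$. $P$ satisfies the *single-use condition* if on every path of the symbolic execution that reaches a value, each $\alpha_i$ occurs at most once in that value, at most once in each recorded constraint and at most once in each recorded score. **Statement.** Let $\mathcal F$ be as above, let $P$ be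 a closed SPCF term of type $\mathbf R$ over $\mathcal F$ that is almost surely terminating and satisfies the single-use condition, and let $I$ be an interval. Then there is a sequence $\mathcal T_1,\mathcal T_2,\dots$ of finite compatible sets of interval traces such that $$\lim_{n\to\infty}\mathrm{lower}_P^{\mathcal T_n}(I)=\llbracket P\rrbracket(I)\quad\text{in }[0,\infty].$$ -/

import Mathlib

open scoped ENNReal NNReal Topology

namespace SPCF

/-! ### Intervals, boxes and interval arithmetic -/

/-- A closed interval `[lo, hi]` of real numbers with `lo ∈ ℝ ∪ {-∞}`, `hi ∈ ℝ ∪ {∞}` and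
`lo ≤ hi`. -/
@[ext]
structure Interval where
  lo : EReal
  hi : EReal
  lo_ne_top : lo ≠ ⊤
  hi_ne_bot : hi ≠ ⊥
  lo_le_hi : lo ≤ hi

namespace Interval

/-- The set of real numbers denoted by an interval. -/
def toSet (I : Interval) : Set ℝ := {x | I.lo ≤ (x : EReal) ∧ (x : EReal) ≤ I.hi}

theorem toSet_nonempty (I : Interval) : I.toSet.Nonempty := by
  by_cases hlo : I.lo = ⊥
  · by_cases hhi : I.hi = ⊤
    · exact ⟨0, by simp [toSet, hlo, hhi]⟩
    · refine ⟨I.hi.toReal, ?_⟩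
      simp [toSet, hlo, EReal.coe_toReal hhi I.hi_ne_bot]
  · refine ⟨I.lo.toReal, ?_⟩
    simp [toSet, EReal.coe_toReal I.lo_ne_top hlo, I.lo_le_hi]

/-- The one-point interval `[r, r]`. -/
noncomputable def point (r : ℝ) : Interval := ⟨r, r, EReal.coe_ne_top r, EReal.coe_ne_bot r, le_rfl⟩

/-- The interval `[0, ∞]`. -/
noncomputable def nonneg : Interval := ⟨0, ⊤, EReal.zero_ne_top, top_ne_bot, le_top⟩

/-- The interval `[-∞, ∞]`. -/
noncomputable def full : Interval := ⟨⊥, ⊤, bot_ne_top, top_ne_bot, le_top⟩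

/-- Two intervals `[a₁, b₁]`, `[a₂, b₂]` are almost disjoint if `b₁ ≤ a₂` or `b₂ ≤ a₁`. -/
def AlmostDisjoint (I J : Interval) : Prop := I.hi ≤ J.lo ∨ J.hi ≤ I.lo

end Interval

/-- An `n`-dimensional box: a product of `n` intervals. -/
abbrev Box (n : ℕ) := Fin n → Interval

namespace Box

variable {n : ℕ}

/-- The subset of `ℝⁿ` denoted by a box. -/
def toSet (B : Box n) : Set (Fin n → ℝ) := {x | ∀ i, x i ∈ (B i).toSet}

theorem toSet_nonempty (B : Box n) : B.toSet.Nonempty :=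
  ⟨fun i => (B i).toSet_nonempty.choose, fun i => (B i).toSet_nonempty.choose_spec⟩

/-- Two boxes are almost disjoint if their sides are almost disjoint in some coordinate. -/
def AlmostDisjoint (B C : Box n) : Prop := ∃ i, (B i).AlmostDisjoint (C i)

end Box

/-- The interval lifting `f^𝕀` of `f : ℝⁿ → ℝ`: a box `B` is sent to `[inf f(B), sup f(B)]`. -/
noncomputable def liftFun {n : ℕ} (f : (Fin n → ℝ) → ℝ) (B : Box n) : Interval where
  lo := ⨅ x ∈ B.toSet, (f x : EReal)
  hi := ⨆ x ∈ B.toSet, (f x : EReal)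
  lo_ne_top := by
    obtain ⟨x, hx⟩ := B.toSet_nonempty
    exact ((iInf₂_le x hx).trans_lt (EReal.coe_lt_top (f x))).ne
  hi_ne_bot := by
    obtain ⟨x, hx⟩ := B.toSet_nonempty
    exact ((EReal.bot_lt_coe (f x)).trans_le (le_iSup₂ (f := fun x _ => (f x : EReal)) x hx)).ne'
  lo_le_hi := by
    obtain ⟨x, hx⟩ := B.toSet_nonempty
    exact (iInf₂_le x hx).trans (le_iSup₂ (f := fun x _ => (f x : EReal)) x hx)

/-- Interval multiplication `×^𝕀`, the lifting of multiplication of real numbers. -/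
noncomputable def Interval.mul (I J : Interval) : Interval :=
  liftFun (fun x : Fin 2 → ℝ => x 0 * x 1) ![I, J]

/-! ### Primitive functions -/

/-- A set of primitive functions, sorted by arity. -/
abbrev PrimSet := ∀ n : ℕ, Set ((Fin n → ℝ) → ℝ)

/-- `f` is boxwise continuous: `ℝⁿ` is the union of countably many pairwise almost disjoint boxes
on each of which `f` is continuous. -/
def BoxwiseContinuous {n : ℕ} (f : (Fin n → ℝ) → ℝ) : Prop :=
  ∃ 𝓑 : Set (Box n), 𝓑.Countable ∧ 𝓑.Pairwise Box.AlmostDisjoint ∧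
    (⋃ B ∈ 𝓑, B.toSet) = Set.univ ∧ ∀ B ∈ 𝓑, ContinuousOn f B.toSet

/-- `f` is interval separable: the preimage of every interval contains a countable union of boxes
that exhausts it up to a Lebesgue null set. -/
def IntervalSeparable {n : ℕ} (f : (Fin n → ℝ) → ℝ) : Prop :=
  ∀ J : Interval, ∃ 𝓑 : Set (Box n), 𝓑.Countable ∧
    (⋃ B ∈ 𝓑, B.toSet) ⊆ f ⁻¹' J.toSet ∧
    MeasureTheory.volume (f ⁻¹' J.toSet \ ⋃ B ∈ 𝓑, B.toSet) = 0

/-- The set `F` together with the identity function on `ℝ`, that is, a bare variable. -/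
def PrimSet.withId (F : PrimSet) : PrimSet :=
  fun n => F n ∪ {g | n = 1 ∧ ∃ j : Fin n, g = fun x => x j}

/-- The composition `(x₁, …, xₘ) ↦ f (g₁ x₁, …, gₘ xₘ)`, where `xᵢ` is a tuple of length `kᵢ`. -/
def comp {m : ℕ} (f : (Fin m → ℝ) → ℝ) (k : Fin m → ℕ) (g : ∀ i, (Fin (k i) → ℝ) → ℝ) :
    (Fin (∑ i, k i) → ℝ) → ℝ :=
  fun x => f fun i => g i fun j => x (finSigmaFinEquiv ⟨i, j⟩)

/-- The standing assumptions on the set of primitive functions. In compositions, an argument of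
a primitive function may be a composite expression or a bare variable. -/
structure PrimSet.Admissible (F : PrimSet) : Prop where
  measurable : ∀ (n : ℕ), ∀ f ∈ F n, Measurable f
  boxwiseContinuous : ∀ (n : ℕ), ∀ f ∈ F n, BoxwiseContinuous f
  intervalSeparable : ∀ (n : ℕ), ∀ f ∈ F n, IntervalSeparable f
  const_mem : ∀ (n : ℕ) (c : ℝ), (fun _ => c) ∈ F n
  comp_mem : ∀ (m : ℕ), ∀ f ∈ F m, ∀ (k : Fin m → ℕ) (g : ∀ i, (Fin (k i) → ℝ) → ℝ),
    (∀ i, g i ∈ F.withId (k i)) → comp f k g ∈ F (∑ i, k i)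

/-! ### Types and (intrinsically typed) terms -/

/-- Simple types over the ground type `real`. -/
inductive Ty : Type
  | real : Ty
  | arr : Ty → Ty → Ty

/-- Typed de Bruijn variables. -/
inductive Var : List Ty → Ty → Type
  | zero {Γ : List Ty} {a : Ty} : Var (a :: Γ) a
  | succ {Γ : List Ty} {a b : Ty} : Var Γ a → Var (b :: Γ) a

/-- `Tm F L Γ a` is the type of terms `M` with `Γ ⊢ M : a`, with primitive functions from `F` and
literals of ground type from `L`. Taking for `L` the real numbers, the intervals, or the real
numbers and sample variables, one obtains the terms of SPCF, the interval terms and the symbolic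
terms. In `fix M` (that is, `μ φ x. M`) the variable `0` of `M` is the argument `x` and the
variable `1` is the function `φ`. -/
inductive Tm (F : PrimSet) (L : Type) : List Ty → Ty → Type
  | var {Γ : List Ty} {a : Ty} : Var Γ a → Tm F L Γ a
  | lit {Γ : List Ty} : L → Tm F L Γ Ty.real
  | lam {Γ : List Ty} {a b : Ty} : Tm F L (a :: Γ) b → Tm F L Γ (Ty.arr a b)
  | fix {Γ : List Ty} {a b : Ty} : Tm F L (a :: Ty.arr a b :: Γ) b → Tm F L Γ (Ty.arr a b)
  | app {Γ : List Ty} {a b : Ty} : Tm F L Γ (Ty.arr a b) → Tm F L Γ a → Tm F L Γ b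
  | ite {Γ : List Ty} {a : Ty} : Tm F L Γ Ty.real → Tm F L Γ a → Tm F L Γ a → Tm F L Γ a
  | prim {Γ : List Ty} {n : ℕ} (f : (Fin n → ℝ) → ℝ) (hf : f ∈ F n) :
      (Fin n → Tm F L Γ Ty.real) → Tm F L Γ Ty.real
  | sample {Γ : List Ty} : Tm F L Γ Ty.real
  | score {Γ : List Ty} : Tm F L Γ Ty.real → Tm F L Γ Ty.real

/-- Extension of a renaming under a binder. -/
def liftRen {Γ Δ : List Ty} (ρ : ∀ a, Var Γ a → Var Δ a) (b : Ty) :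
    ∀ a, Var (b :: Γ) a → Var (b :: Δ) a
  | _, Var.zero => Var.zero
  | _, Var.succ v => Var.succ (ρ _ v)

namespace Tm

variable {F : PrimSet} {L L' : Type}

/-- Renaming of variables. -/
def rename : ∀ {Γ Δ : List Ty} {a : Ty},
    (∀ b, Var Γ b → Var Δ b) → Tm F L Γ a → Tm F L Δ a
  | _, _, _, ρ, var v => var (ρ _ v)
  | _, _, _, _, lit r => lit r
  | _, _, _, ρ, lam M => lam (rename (liftRen ρ _) M)
  | _, _, _, ρ, fix M => fix (rename (liftRen (liftRen ρ _) _) M)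
  | _, _, _, ρ, app M N => app (rename ρ M) (rename ρ N)
  | _, _, _, ρ, ite M N P => ite (rename ρ M) (rename ρ N) (rename ρ P)
  | _, _, _, ρ, prim f hf args => prim f hf fun i => rename ρ (args i)
  | _, _, _, _, sample => sample
  | _, _, _, ρ, score M => score (rename ρ M)

/-- Extension of a substitution under a binder. -/
def liftSub {Γ Δ : List Ty} (σ : ∀ a, Var Γ a → Tm F L Δ a) (b : Ty) :
    ∀ a, Var (b :: Γ) a → Tm F L (b :: Δ) a
  | _, Var.zero => var Var.zero
  | _, Var.succ v => rename (fun _ => Var.succ) (σ _ v)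

/-- Capture-avoiding simultaneous substitution. -/
def subst : ∀ {Γ Δ : List Ty} {a : Ty},
    (∀ b, Var Γ b → Tm F L Δ b) → Tm F L Γ a → Tm F L Δ a
  | _, _, _, σ, var v => σ _ v
  | _, _, _, _, lit r => lit r
  | _, _, _, σ, lam M => lam (subst (liftSub σ _) M)
  | _, _, _, σ, fix M => fix (subst (liftSub (liftSub σ _) _) M)
  | _, _, _, σ, app M N => app (subst σ M) (subst σ N)
  | _, _, _, σ, ite M N P => ite (subst σ M) (subst σ N) (subst σ P)
  | _, _, _, σ, prim f hf args => prim f hf fun i => subst σ (args i)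
  | _, _, _, _, sample => sample
  | _, _, _, σ, score M => score (subst σ M)

/-- Extension of a substitution by a term for a new variable `0`. -/
def consSub {Γ Δ : List Ty} {b : Ty} (V : Tm F L Δ b) (σ : ∀ a, Var Γ a → Tm F L Δ a) :
    ∀ a, Var (b :: Γ) a → Tm F L Δ a
  | _, Var.zero => V
  | _, Var.succ v => σ _ v

/-- `M[V/x]`, where `x` is the variable `0` of `M`. -/
def inst {Γ : List Ty} {a b : Ty} (M : Tm F L (a :: Γ) b) (V : Tm F L Γ a) : Tm F L Γ b :=
  subst (consSub V fun _ => var) M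

/-- `M[V/x, W/φ]`, where `x` is the variable `0` and `φ` the variable `1` of `M`. -/
def inst₂ {Γ : List Ty} {a b c : Ty} (M : Tm F L (a :: c :: Γ) b) (V : Tm F L Γ a)
    (W : Tm F L Γ c) : Tm F L Γ b :=
  subst (consSub V (consSub W fun _ => var)) M

/-- Replacement of the literals of a term. -/
def mapLit (h : L → L') : ∀ {Γ : List Ty} {a : Ty}, Tm F L Γ a → Tm F L' Γ a
  | _, _, var v => var v
  | _, _, lit r => lit (h r)
  | _, _, lam M => lam (mapLit h M)
  | _, _, fix M => fix (mapLit h M)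
  | _, _, app M N => app (mapLit h M) (mapLit h N)
  | _, _, ite M N P => ite (mapLit h M) (mapLit h N) (mapLit h P)
  | _, _, prim f hf args => prim f hf fun i => mapLit h (args i)
  | _, _, sample => sample
  | _, _, score M => score (mapLit h M)

/-- Values of SPCF and of interval SPCF. -/
inductive IsVal : ∀ {Γ : List Ty} {a : Ty}, Tm F L Γ a → Prop
  | var {Γ : List Ty} {a : Ty} (v : Var Γ a) : IsVal (var v)
  | lit {Γ : List Ty} (r : L) : IsVal (lit r : Tm F L Γ Ty.real)
  | lam {Γ : List Ty} {a b : Ty} (M : Tm F L (a :: Γ) b) : IsVal (lam M)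
  | fix {Γ : List Ty} {a b : Ty} (M : Tm F L (a :: Ty.arr a b :: Γ) b) : IsVal (fix M)

/-- Symbolic values: here a primitive function applied to values is a value, too. -/
inductive IsSymVal : ∀ {Γ : List Ty} {a : Ty}, Tm F L Γ a → Prop
  | var {Γ : List Ty} {a : Ty} (v : Var Γ a) : IsSymVal (var v)
  | lit {Γ : List Ty} (r : L) : IsSymVal (lit r : Tm F L Γ Ty.real)
  | lam {Γ : List Ty} {a b : Ty} (M : Tm F L (a :: Γ) b) : IsSymVal (lam M)
  | fix {Γ : List Ty} {a b : Ty} (M : Tm F L (a :: Ty.arr a b :: Γ) b) : IsSymVal (fix M)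
  | prim {Γ : List Ty} {n : ℕ} (f : (Fin n → ℝ) → ℝ) (hf : f ∈ F n)
      (args : Fin n → Tm F L Γ Ty.real) :
      (∀ i, IsSymVal (args i)) → IsSymVal (prim f hf args)

/-- The closure of a relation on configurations (closed term, state) under left-to-right
call-by-value evaluation contexts
`E ::= [·] | E M | V E | if(E, N, P) | f(V₁, …, Vᵢ₋₁, E, Mᵢ₊₁, …, Mₙ) | score(E)`,
where the values are given by the predicate `val`. -/
inductive CtxClosure {S : Type} (val : ∀ a, Tm F L [] a → Prop)
    (red : ∀ a, Tm F L [] a → S → Tm F L [] a → S → Prop) :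
    ∀ {a : Ty}, Tm F L [] a → S → Tm F L [] a → S → Prop
  | redex {a : Ty} {M M' : Tm F L [] a} {s s' : S} :
      red a M s M' s' → CtxClosure val red M s M' s'
  | appLeft {a b : Ty} {M M' : Tm F L [] (Ty.arr a b)} {s s' : S} (N : Tm F L [] a) :
      CtxClosure val red M s M' s' → CtxClosure val red (app M N) s (app M' N) s'
  | appRight {a b : Ty} {V : Tm F L [] (Ty.arr a b)} {N N' : Tm F L [] a} {s s' : S} :
      val (Ty.arr a b) V → CtxClosure val red N s N' s' →
      CtxClosure val red (app V N) s (app V N') s'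
  | ite {a : Ty} {M M' : Tm F L [] Ty.real} {s s' : S} (N P : Tm F L [] a) :
      CtxClosure val red M s M' s' → CtxClosure val red (ite M N P) s (ite M' N P) s'
  | prim {n : ℕ} (f : (Fin n → ℝ) → ℝ) (hf : f ∈ F n) (args : Fin n → Tm F L [] Ty.real)
      (i : Fin n) {M' : Tm F L [] Ty.real} {s s' : S} :
      (∀ j, j < i → val Ty.real (args j)) → CtxClosure val red (args i) s M' s' →
      CtxClosure val red (prim f hf args) s (prim f hf (Function.update args i M')) s'
  | score {M M' : Tm F L [] Ty.real} {s s' : S} :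
      CtxClosure val red M s M' s' → CtxClosure val red (score M) s (score M') s'

/-- Many-step reduction of closed terms of ground type: the reflexive transitive closure of
`CtxClosure`. -/
def Reduces {S : Type} (val : ∀ a, Tm F L [] a → Prop)
    (red : ∀ a, Tm F L [] a → S → Tm F L [] a → S → Prop) :
    Tm F L [] Ty.real × S → Tm F L [] Ty.real × S → Prop :=
  Relation.ReflTransGen fun c c' => CtxClosure val red c.1 c.2 c'.1 c'.2

end Tm

open Tm

/-- A program: a closed term of SPCF of ground type. -/
abbrev Program (F : PrimSet) := Tm F ℝ [] Ty.real

variable {F : PrimSet}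

/-! ### Trace semantics -/

/-- The redex rules of SPCF. A state consists of a trace and a weight. -/
inductive Redex : ∀ a, Tm F ℝ [] a → List unitInterval × ℝ≥0 →
    Tm F ℝ [] a → List unitInterval × ℝ≥0 → Prop
  | beta {a b : Ty} (M : Tm F ℝ [a] b) {V : Tm F ℝ [] a} (s w) :
      IsVal V → Redex b (app (lam M) V) (s, w) (inst M V) (s, w)
  | fix {a b : Ty} (M : Tm F ℝ [a, Ty.arr a b] b) {V : Tm F ℝ [] a} (s w) :
      IsVal V → Redex b (app (fix M) V) (s, w) (inst₂ M V (fix M)) (s, w)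
  | sample (r : unitInterval) (s w) : Redex Ty.real sample (r :: s, w) (lit (r : ℝ)) (s, w)
  | prim {n : ℕ} (f : (Fin n → ℝ) → ℝ) (hf : f ∈ F n) (args : Fin n → Tm F ℝ [] Ty.real)
      (r : Fin n → ℝ) (s w) :
      (∀ i, args i = lit (r i)) → Redex Ty.real (prim f hf args) (s, w) (lit (f r)) (s, w)
  | iteLeft {a : Ty} {r : ℝ} (N P : Tm F ℝ [] a) (s w) :
      r ≤ 0 → Redex a (ite (lit r) N P) (s, w) N (s, w)
  | iteRight {a : Ty} {r : ℝ} (N P : Tm F ℝ [] a) (s w) :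
      0 < r → Redex a (ite (lit r) N P) (s, w) P (s, w)
  | score {r : ℝ} (s w) :
      0 ≤ r → Redex Ty.real (score (lit r)) (s, w) (lit r) (s, w * r.toNNReal)

/-- `P`, run on the trace `s` with initial weight `1`, uses up `s` and returns the value `r` with
the weight `w`. -/
def Evaluates (P : Program F) (s : List unitInterval) (r : ℝ) (w : ℝ≥0) : Prop :=
  Reduces (fun _ => IsVal) Redex (P, (s, 1)) (lit r, ([], w))

/-- The space of concrete traces `⋃ₙ [0,1]ⁿ`. Its σ-algebra, that of a disjoint union, consists of
the sets `⋃ₙ Uₙ` with `Uₙ ⊆ [0,1]ⁿ` Borel. -/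
abbrev Trace := Σ n : ℕ, (Fin n → unitInterval)

/-- A concrete trace as a list. -/
def Trace.toList (s : Trace) : List unitInterval := List.ofFn s.2

/-- The measure `U ↦ ∑ₙ λₙ (U ∩ [0,1]ⁿ)` on the space of traces. -/
noncomputable def traceMeasure : MeasureTheory.Measure Trace :=
  MeasureTheory.Measure.sum fun n =>
    MeasureTheory.Measure.map (Sigma.mk n)
      (MeasureTheory.volume : MeasureTheory.Measure (Fin n → unitInterval))

/-- The set of traces on which `P` terminates with a value in `U`. -/
def valuePreimage (P : Program F) (U : Set ℝ) : Set Trace :=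
  {s | ∃ r w, Evaluates P s.toList r w ∧ r ∈ U}

open Classical in
/-- The weight of the execution of `P` on a trace, which is `0` if the trace is not terminating.
As reduction is deterministic, the choice below is a choice from a one-element set. -/
noncomputable def weight (P : Program F) (s : Trace) : ℝ≥0 :=
  if h : ∃ w, ∃ r, Evaluates P s.toList r w then h.choose else 0

/-- The denotation `⟦P⟧(U)`: the integral of the weight over the traces with value in `U`. -/
noncomputable def denotation (P : Program F) (U : Set ℝ) : ℝ≥0∞ :=
  ∫⁻ s, (valuePreimage P U).indicator (fun s => (weight P s : ℝ≥0∞)) s ∂traceMeasure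

/-- Almost sure termination. -/
def AlmostSurelyTerminating (P : Program F) : Prop :=
  traceMeasure (valuePreimage P Set.univ) = 1

/-! ### Interval trace semantics -/

/-- Intervals with endpoints in `[0, 1]`. -/
abbrev UnitSubinterval := {I : Interval // 0 ≤ I.lo ∧ I.hi ≤ 1}

/-- Interval traces. -/
abbrev IntervalTrace := List UnitSubinterval

/-- The redex rules of interval SPCF. A state consists of an interval trace and an interval
weight. -/
inductive IntervalRedex : ∀ a, Tm F Interval [] a → IntervalTrace × Interval →
    Tm F Interval [] a → IntervalTrace × Interval → Prop
  | beta {a b : Ty} (M : Tm F Interval [a] b) {V : Tm F Interval [] a} (t w) :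
      IsVal V → IntervalRedex b (app (lam M) V) (t, w) (inst M V) (t, w)
  | fix {a b : Ty} (M : Tm F Interval [a, Ty.arr a b] b) {V : Tm F Interval [] a} (t w) :
      IsVal V → IntervalRedex b (app (fix M) V) (t, w) (inst₂ M V (fix M)) (t, w)
  | sample (I : UnitSubinterval) (t w) :
      IntervalRedex Ty.real sample (I :: t, w) (lit (I : Interval)) (t, w)
  | prim {n : ℕ} (f : (Fin n → ℝ) → ℝ) (hf : f ∈ F n)
      (args : Fin n → Tm F Interval [] Ty.real) (B : Fin n → Interval) (t w) :
      (∀ i, args i = lit (B i)) →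
      IntervalRedex Ty.real (prim f hf args) (t, w) (lit (liftFun f B)) (t, w)
  | iteLeft {a : Ty} {I : Interval} (N P : Tm F Interval [] a) (t w) :
      I.hi ≤ 0 → IntervalRedex a (ite (lit I) N P) (t, w) N (t, w)
  | iteRight {a : Ty} {I : Interval} (N P : Tm F Interval [] a) (t w) :
      0 < I.lo → IntervalRedex a (ite (lit I) N P) (t, w) P (t, w)
  | score {I : Interval} (t w) :
      0 ≤ I.lo → IntervalRedex Ty.real (score (lit I)) (t, w) (lit I) (t, w.mul I)

/-- `P`, run as an interval term (a literal `r` being read as `[r, r]`) on the interval trace `t`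
with initial weight `[1, 1]`, uses up `t` and returns the interval `I` with the weight `w`. -/
def IntervalEvaluates (P : Program F) (t : IntervalTrace) (I w : Interval) : Prop :=
  Reduces (fun _ => IsVal) IntervalRedex (P.mapLit Interval.point, (t, Interval.point 1))
    (lit I, ([], w))

open Classical in
/-- The interval weight function; the choice is from a one-element set. -/
noncomputable def intervalWeight (P : Program F) (t : IntervalTrace) : Interval :=
  if h : ∃ w, ∃ I, IntervalEvaluates P t I w then h.choose else Interval.nonneg

open Classical in
/-- The interval value function; the choice is from a one-element set. -/
noncomputable def intervalValue (P : Program F) (t : IntervalTrace) : Interval :=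
  if h : ∃ I, ∃ w, IntervalEvaluates P t I w then h.choose else Interval.full

/-- Two interval traces are compatible if they are almost disjoint at some common position. -/
def CompatibleTraces (t u : IntervalTrace) : Prop :=
  ∃ (i : ℕ) (ht : i < t.length) (hu : i < u.length),
    Interval.AlmostDisjoint (t[i] : UnitSubinterval).1 (u[i] : UnitSubinterval).1

/-- A set of interval traces is compatible if its (distinct) elements are pairwise compatible. -/
def Compatible (T : Set IntervalTrace) : Prop := T.Pairwise CompatibleTraces

/-- The volume of an interval trace. -/
noncomputable def traceVolume (t : IntervalTrace) : ℝ≥0∞ :=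
  (t.map fun I => (I.1.hi - I.1.lo).toENNReal).prod

open Classical in
/-- The lower bound on `⟦P⟧(U)` obtained from the set `T` of interval traces. -/
noncomputable def lowerBound (P : Program F) (T : Set IntervalTrace) (U : Set ℝ) : ℝ≥0∞ :=
  ∑' t : T, traceVolume t.1 * (intervalWeight P t.1).lo.toENNReal *
    (if (intervalValue P t.1).toSet ⊆ U then 1 else 0)

/-! ### Symbolic execution and the single-use condition -/

/-- Literals of symbolic terms: real constants and the sample variables `α₁, α₂, …`. -/
inductive SymLit : Type
  | const : ℝ → SymLit
  | sampleVar : ℕ → SymLit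

/-- Relation symbols of symbolic constraints. -/
inductive Rel : Type
  | le | lt | ge | gt

/-- A symbolic constraint `𝒱 ⋈ r`. -/
structure SymConstraint (F : PrimSet) where
  term : Tm F SymLit [] Ty.real
  rel : Rel
  bound : ℝ

/-- The state of a symbolic configuration: the number of sample variables used so far, the
recorded constraints and the recorded scores. -/
structure SymState (F : PrimSet) where
  numSamples : ℕ
  constraints : List (SymConstraint F)
  scores : List (Tm F SymLit [] Ty.real)

/-- The redex rules of symbolic execution. -/
inductive SymRedex : ∀ a, Tm F SymLit [] a → SymState F → Tm F SymLit [] a → SymState F → Prop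
  | beta {a b : Ty} (M : Tm F SymLit [a] b) {V : Tm F SymLit [] a} (q) :
      IsSymVal V → SymRedex b (app (lam M) V) q (inst M V) q
  | fix {a b : Ty} (M : Tm F SymLit [a, Ty.arr a b] b) {V : Tm F SymLit [] a} (q) :
      IsSymVal V → SymRedex b (app (fix M) V) q (inst₂ M V (fix M)) q
  | sample (n Δ Ξ) :
      SymRedex Ty.real sample ⟨n, Δ, Ξ⟩ (lit (SymLit.sampleVar (n + 1))) ⟨n + 1, Δ, Ξ⟩
  | iteLeft {a : Ty} {V : Tm F SymLit [] Ty.real} (N P : Tm F SymLit [] a) (n Δ Ξ) :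
      IsSymVal V → SymRedex a (ite V N P) ⟨n, Δ, Ξ⟩ N ⟨n, ⟨V, Rel.le, 0⟩ :: Δ, Ξ⟩
  | iteRight {a : Ty} {V : Tm F SymLit [] Ty.real} (N P : Tm F SymLit [] a) (n Δ Ξ) :
      IsSymVal V → SymRedex a (ite V N P) ⟨n, Δ, Ξ⟩ P ⟨n, ⟨V, Rel.gt, 0⟩ :: Δ, Ξ⟩
  | score {V : Tm F SymLit [] Ty.real} (n Δ Ξ) :
      IsSymVal V → SymRedex Ty.real (score V) ⟨n, Δ, Ξ⟩ V ⟨n, ⟨V, Rel.ge, 0⟩ :: Δ, V :: Ξ⟩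

/-- `(V, q)` is a symbolic path of the program `P`: a symbolic value together with a state that is
reached by symbolic execution of `P`. -/
def IsSymPath (P : Program F) (V : Tm F SymLit [] Ty.real) (q : SymState F) : Prop :=
  IsSymVal V ∧ Reduces (fun _ => IsSymVal) SymRedex (P.mapLit SymLit.const, ⟨0, [], []⟩) (V, q)

open Classical in
/-- The number of occurrences of the sample variable `αⱼ` in a symbolic term. -/
noncomputable def occurrences (j : ℕ) : ∀ {Γ : List Ty} {a : Ty}, Tm F SymLit Γ a → ℕ
  | _, _, Tm.var _ => 0
  | _, _, Tm.lit l => if l = SymLit.sampleVar j then 1 else 0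
  | _, _, Tm.lam M => occurrences j M
  | _, _, Tm.fix M => occurrences j M
  | _, _, Tm.app M N => occurrences j M + occurrences j N
  | _, _, Tm.ite M N P => occurrences j M + occurrences j N + occurrences j P
  | _, _, Tm.prim _ _ args => ∑ i, occurrences j (args i)
  | _, _, Tm.sample => 0
  | _, _, Tm.score M => occurrences j M

/-- On every symbolic path of `P`, every sample variable occurs at most once in the result value,
at most once in each constraint and at most once in each score. -/
def SingleUse (P : Program F) : Prop :=
  ∀ (V : Tm F SymLit [] Ty.real) (q : SymState F), IsSymPath P V q → ∀ j : ℕ,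
    occurrences j V ≤ 1 ∧ (∀ C ∈ q.constraints, occurrences j C.term ≤ 1) ∧
      ∀ W ∈ q.scores, occurrences j W ≤ 1

end SPCF

/-! The denotation is the integral of the function g on traces that is the weight where the value
lies in `I` and zero elsewhere. Cut [0,1] into k + 1 equal cells and let T_k consist of the
terminating interval traces of length at most k whose entries are cells. The lower bound given by
T_k is the integral of a step function g_k (`lowerBound_gridFamily`). Soundness of interval
execution gives g_k ≤ g everywhere (`gridFun_le`). Together with g ≤ liminf g_k almost everywhere
(`ae_le_liminf_gridFun`), Fatou's lemma yields convergence.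

For the second inequality, a terminating trace s follows one of countably many symbolic paths, so
null sets may be discarded path by path. The interval run on the grid box around s follows the same
path as soon as the constraints of the path hold on that box (`IsSymPath.intervalEvaluates`). It
remains to see that for almost every s the interval evaluation of a symbolic value W on the
shrinking boxes around s converges to W(s), and that it ends up inside a closed interval J if W(s)
lies in J.

Single use enters twice. First, W is a member of `F`, or the identity, applied to distinct
coordinates (`exists_mem_withId`); by interval separability almost every point of the preimage of J
is interior to a box inside that preimage (`ae_eventually_realEval_mem`). Taking for J the sides of
the boxes on which the primitive functions in W are continuous, one finds that W is continuous on
small boxes around almost every point. Secondly, the arguments of a primitive function share no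
variable, so on such boxes interval evaluation returns exactly the image of W (`toSet_boxEval`),
which lies in J. -/

namespace SPCF

open Tm

variable {F : PrimSet}

/-! ### Determinism of reduction -/

namespace Tm

variable {L : Type} {S S' : Type} {val : ∀ a, Tm F L [] a → Prop}
  {red : ∀ a, Tm F L [] a → S → Tm F L [] a → S → Prop}

/-- Sufficient conditions for the reduction generated by `red` to be deterministic. -/
structure RedexSystem (val : ∀ a, Tm F L [] a → Prop)
    (red : ∀ a, Tm F L [] a → S → Tm F L [] a → S → Prop) : Prop where
  functional : ∀ {a M s M₁ s₁ M₂ s₂}, red a M s M₁ s₁ → red a M s M₂ s₂ → M₁ = M₂ ∧ s₁ = s₂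
  not_red : ∀ {a V s M' s'}, val a V → ¬ red a V s M' s'
  not_val_app : ∀ {a b} {M : Tm F L [] (Ty.arr a b)} {N : Tm F L [] a}, ¬ val b (app M N)
  not_val_ite : ∀ {a} {M : Tm F L [] Ty.real} {N P : Tm F L [] a}, ¬ val a (ite M N P)
  not_val_score : ∀ {M : Tm F L [] Ty.real}, ¬ val Ty.real (score M)
  -- Vacuous for `IsVal`; for `IsSymVal`, applied primitive functions are values and irreducibility
  -- has to descend into them.
  val_prim : ∀ {n} {f : (Fin n → ℝ) → ℝ} {hf : f ∈ F n} {args : Fin n → Tm F L [] Ty.real},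
    val Ty.real (prim f hf args) → ∀ i, val Ty.real (args i)
  red_app : ∀ {a b} {M : Tm F L [] (Ty.arr a b)} {N : Tm F L [] a} {s M' s'},
    red b (app M N) s M' s' → val _ M ∧ val _ N
  red_ite : ∀ {a} {M : Tm F L [] Ty.real} {N P : Tm F L [] a} {s M' s'},
    red a (ite M N P) s M' s' → val _ M
  red_score : ∀ {M : Tm F L [] Ty.real} {s M' s'}, red _ (score M) s M' s' → val _ M
  red_prim : ∀ {n} {f : (Fin n → ℝ) → ℝ} {hf : f ∈ F n} {args : Fin n → Tm F L [] Ty.real}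
    {s M' s'}, red _ (prim f hf args) s M' s' → ∀ i, val Ty.real (args i)

theorem RedexSystem.irreducible (h : RedexSystem val red) {a : Ty} {V M' : Tm F L [] a}
    {s s' : S} (hV : val a V) : ¬ CtxClosure val red V s M' s' := by
  intro hs
  induction hs with
  | redex hr => exact h.not_red hV hr
  | appLeft => exact h.not_val_app hV
  | appRight => exact h.not_val_app hV
  | ite => exact h.not_val_ite hV
  | prim f hf args i _ _ ih => exact ih (h.val_prim hV i)
  | score => exact h.not_val_score hV

theorem RedexSystem.unique (h : RedexSystem val red) {a : Ty} {M M₁ M₂ : Tm F L [] a}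
    {s s₁ s₂ : S} (h₁ : CtxClosure val red M s M₁ s₁) (h₂ : CtxClosure val red M s M₂ s₂) :
    M₁ = M₂ ∧ s₁ = s₂ := by
  induction h₁ with
  | redex hr =>
    cases h₂ with
    | redex hr' => exact h.functional hr hr'
    | appLeft _ hs => exact absurd hs (h.irreducible (h.red_app hr).1)
    | appRight _ hs => exact absurd hs (h.irreducible (h.red_app hr).2)
    | ite _ _ hs => exact absurd hs (h.irreducible (h.red_ite hr))
    | prim _ _ _ i _ hs => exact absurd hs (h.irreducible (h.red_prim hr i))
    | score hs => exact absurd hs (h.irreducible (h.red_score hr))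
  | appLeft N hs ih =>
    cases h₂ with
    | redex hr => exact absurd hs (h.irreducible (h.red_app hr).1)
    | appLeft _ hs' => obtain ⟨rfl, rfl⟩ := ih hs'; exact ⟨rfl, rfl⟩
    | appRight hv _ => exact absurd hs (h.irreducible hv)
  | appRight hv hs ih =>
    cases h₂ with
    | redex hr => exact absurd hs (h.irreducible (h.red_app hr).2)
    | appLeft _ hs' => exact absurd hs' (h.irreducible hv)
    | appRight _ hs' => obtain ⟨rfl, rfl⟩ := ih hs'; exact ⟨rfl, rfl⟩
  | ite N P hs ih =>
    cases h₂ with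
    | redex hr => exact absurd hs (h.irreducible (h.red_ite hr))
    | ite _ _ hs' => obtain ⟨rfl, rfl⟩ := ih hs'; exact ⟨rfl, rfl⟩
  | prim f hf args i hv hs ih =>
    cases h₂ with
    | redex hr => exact absurd hs (h.irreducible (h.red_prim hr i))
    | prim _ _ _ j hv' hs' =>
      rcases lt_trichotomy i j with hij | rfl | hij
      · exact absurd hs (h.irreducible (hv' i hij))
      · obtain ⟨rfl, rfl⟩ := ih hs'; exact ⟨rfl, rfl⟩
      · exact absurd hs' (h.irreducible (hv j hij))
  | score hs ih =>
    cases h₂ with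
    | redex hr => exact absurd hs (h.irreducible (h.red_score hr))
    | score hs' => obtain ⟨rfl, rfl⟩ := ih hs'; exact ⟨rfl, rfl⟩

/-- Normal forms reached from the same configuration coincide. -/
theorem RedexSystem.unique_value (h : RedexSystem val red) {c c₁ c₂ : Tm F L [] Ty.real × S}
    (h₁ : Reduces val red c c₁) (h₂ : Reduces val red c c₂) (hv₁ : val _ c₁.1)
    (hv₂ : val _ c₂.1) : c₁ = c₂ := by
  have hr : Relator.RightUnique
      fun c c' : Tm F L [] Ty.real × S => CtxClosure val red c.1 c.2 c'.1 c'.2 := by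
    intro a b c hab hac
    obtain ⟨h1, h2⟩ := h.unique hab hac
    exact Prod.ext h1 h2
  rcases Relation.ReflTransGen.total_of_right_unique hr h₁ h₂ with h' | h'
  · rcases Relation.ReflTransGen.cases_head h' with rfl | ⟨d, hd, _⟩
    · rfl
    · exact absurd hd (h.irreducible hv₁)
  · rcases Relation.ReflTransGen.cases_head h' with rfl | ⟨d, hd, _⟩
    · rfl
    · exact absurd hd (h.irreducible hv₂)

theorem CtxClosure.mono {red' : ∀ a, Tm F L [] a → S' → Tm F L [] a → S' → Prop} {φ : S → S'}
    (hφ : ∀ a M s M' s', red a M s M' s' → red' a M (φ s) M' (φ s')) {a : Ty}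
    {M M' : Tm F L [] a} {s s' : S} (h : CtxClosure val red M s M' s') :
    CtxClosure val red' M (φ s) M' (φ s') := by
  induction h with
  | redex hr => exact .redex (hφ _ _ _ _ _ hr)
  | appLeft N _ ih => exact .appLeft N ih
  | appRight hv _ ih => exact .appRight hv ih
  | ite N P _ ih => exact .ite N P ih
  | prim f hf args i hv _ ih => exact .prim f hf args i hv ih
  | score _ ih => exact .score ih

theorem CtxClosure.exists_redex {a : Ty} {M M' : Tm F L [] a} {s s' : S}
    (h : CtxClosure val red M s M' s') : ∃ b N N', red b N s N' s' := by
  induction h with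
  | redex hr => exact ⟨_, _, _, hr⟩
  | appLeft _ _ ih => exact ih
  | appRight _ _ ih => exact ih
  | ite _ _ _ ih => exact ih
  | prim _ _ _ _ _ _ ih => exact ih
  | score _ ih => exact ih

end Tm

theorem redexSystem : RedexSystem (F := F) (fun _ => IsVal) Redex where
  functional h₁ h₂ := by
    cases h₁ with
    | beta => cases h₂; exact ⟨rfl, rfl⟩
    | fix => cases h₂; exact ⟨rfl, rfl⟩
    | sample => cases h₂; exact ⟨rfl, rfl⟩
    | prim f hf args r s w hr =>
      cases h₂ with
      | prim _ _ _ r' _ _ hr' =>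
        have : r = r' := funext fun i => by simpa using (hr i).symm.trans (hr' i)
        exact ⟨by rw [this], rfl⟩
    | iteLeft _ _ _ _ h =>
      cases h₂ with
      | iteLeft => exact ⟨rfl, rfl⟩
      | iteRight _ _ _ _ h' => exact absurd h (not_le.2 h')
    | iteRight _ _ _ _ h =>
      cases h₂ with
      | iteRight => exact ⟨rfl, rfl⟩
      | iteLeft _ _ _ _ h' => exact absurd h' (not_le.2 h)
    | score => cases h₂; exact ⟨rfl, rfl⟩
  not_red hV hr := by cases hV <;> cases hr
  not_val_app h := by cases h
  not_val_ite h := by cases h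
  not_val_score h := by cases h
  val_prim h := by cases h
  red_app h := by
    cases h with
    | beta M s w hV => exact ⟨.lam M, hV⟩
    | fix M s w hV => exact ⟨.fix M, hV⟩
  red_ite h := by cases h <;> exact .lit _
  red_score h := by cases h; exact .lit _
  red_prim h := by
    cases h with
    | prim _ _ _ r _ _ hr => exact fun i => by rw [hr i]; exact .lit _

theorem intervalRedexSystem : RedexSystem (F := F) (fun _ => IsVal) IntervalRedex where
  functional h₁ h₂ := by
    cases h₁ with
    | beta => cases h₂; exact ⟨rfl, rfl⟩
    | fix => cases h₂; exact ⟨rfl, rfl⟩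
    | sample => cases h₂; exact ⟨rfl, rfl⟩
    | prim f hf args r s w hr =>
      cases h₂ with
      | prim _ _ _ r' _ _ hr' =>
        have : r = r' := funext fun i => by simpa using (hr i).symm.trans (hr' i)
        exact ⟨by rw [this], rfl⟩
    | @iteLeft _ I _ _ _ _ h =>
      cases h₂ with
      | iteLeft => exact ⟨rfl, rfl⟩
      | iteRight _ _ _ _ h' => exact absurd (I.lo_le_hi.trans h) (not_le.2 h')
    | @iteRight _ I _ _ _ _ h =>
      cases h₂ with
      | iteRight => exact ⟨rfl, rfl⟩
      | iteLeft _ _ _ _ h' => exact absurd (I.lo_le_hi.trans h') (not_le.2 h)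
    | score => cases h₂; exact ⟨rfl, rfl⟩
  not_red hV hr := by cases hV <;> cases hr
  not_val_app h := by cases h
  not_val_ite h := by cases h
  not_val_score h := by cases h
  val_prim h := by cases h
  red_app h := by
    cases h with
    | beta M s w hV => exact ⟨.lam M, hV⟩
    | fix M s w hV => exact ⟨.fix M, hV⟩
  red_ite h := by cases h <;> exact .lit _
  red_score h := by cases h; exact .lit _
  red_prim h := by
    cases h with
    | prim _ _ _ r _ _ hr => exact fun i => by rw [hr i]; exact .lit _

/-! ### Countability of symbolic execution -/

/-- Symbolic redexes in which conditionals take the branch selected by `b`. -/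
def SymRedexOn (b : Bool) (a : Ty) (M : Tm F SymLit [] a) (q : SymState F) (M' : Tm F SymLit [] a)
    (q' : SymState F) : Prop :=
  SymRedex a M q M' q' ∧ ∀ G N P, M = ite G N P →
    q'.constraints = ⟨G, if b then Rel.le else Rel.gt, 0⟩ :: q.constraints

/-- Symbolic execution is nondeterministic only in the choice of a branch. With the choice fixed,
reduction is deterministic, so that a configuration has at most two successors. -/
theorem symRedexSystem (b : Bool) :
    RedexSystem (F := F) (fun _ => IsSymVal) (SymRedexOn b) where
  functional h₁ h₂ := by
    obtain ⟨h₁, e₁⟩ := h₁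
    obtain ⟨h₂, e₂⟩ := h₂
    cases h₁ with
    | beta => cases h₂; exact ⟨rfl, rfl⟩
    | fix => cases h₂; exact ⟨rfl, rfl⟩
    | sample => cases h₂; exact ⟨rfl, rfl⟩
    | iteLeft =>
      cases h₂ with
      | iteLeft => exact ⟨rfl, rfl⟩
      | iteRight =>
        -- The branch is visible in the recorded relation: both rules would have to record the same
        -- one of `le` and `gt`.
        have := (e₁ _ _ _ rfl).trans (e₂ _ _ _ rfl).symm
        simp at this
    | iteRight =>
      cases h₂ with
      | iteRight => exact ⟨rfl, rfl⟩
      | iteLeft =>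
        have := (e₁ _ _ _ rfl).trans (e₂ _ _ _ rfl).symm
        simp at this
    | score => cases h₂; exact ⟨rfl, rfl⟩
  not_red hV hr := by obtain ⟨hr, _⟩ := hr; cases hV <;> cases hr
  not_val_app h := by cases h
  not_val_ite h := by cases h
  not_val_score h := by cases h
  val_prim h := by cases h; assumption
  red_app h := by
    obtain ⟨h, _⟩ := h
    cases h with
    | beta M s hV => exact ⟨.lam M, hV⟩
    | fix M s hV => exact ⟨.fix M, hV⟩
  red_ite h := by obtain ⟨h, _⟩ := h; cases h <;> assumption
  red_score h := by obtain ⟨h, _⟩ := h; cases h; assumption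
  red_prim h := by obtain ⟨h, _⟩ := h; cases h

theorem exists_symRedexOn {a : Ty} {M M' : Tm F SymLit [] a} {q q' : SymState F}
    (h : CtxClosure (fun _ => IsSymVal) SymRedex M q M' q') :
    ∃ b, CtxClosure (fun _ => IsSymVal) (SymRedexOn b) M q M' q' := by
  induction h with
  | redex hr =>
    cases hr with
    -- For redexes other than conditionals the choice of `b` is arbitrary.
    | beta M _ h => exact ⟨true, .redex ⟨.beta M _ h, fun _ _ _ h => by cases h⟩⟩
    | fix M _ h => exact ⟨true, .redex ⟨.fix M _ h, fun _ _ _ h => by cases h⟩⟩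
    | sample n Δ Ξ => exact ⟨true, .redex ⟨.sample n Δ Ξ, fun _ _ _ h => by cases h⟩⟩
    | iteLeft _ _ _ _ _ h =>
      exact ⟨true, .redex ⟨.iteLeft _ _ _ _ _ h, fun _ _ _ h => by cases h; rfl⟩⟩
    | iteRight _ _ _ _ _ h =>
      exact ⟨false, .redex ⟨.iteRight _ _ _ _ _ h, fun _ _ _ h => by cases h; rfl⟩⟩
    | score n Δ Ξ h => exact ⟨true, .redex ⟨.score n Δ Ξ h, fun _ _ _ h => by cases h⟩⟩
  | appLeft N _ ih => exact ih.imp fun b h => .appLeft N h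
  | appRight hv _ ih => exact ih.imp fun b h => .appRight hv h
  | ite N P _ ih => exact ih.imp fun b h => .ite N P h
  | prim f hf args i hv _ ih => exact ih.imp fun b h => .prim f hf args i hv h
  | score _ ih => exact ih.imp fun b h => .score h

/-- A relation with countably many successors at each point reaches only countably many points. -/
theorem _root_.Relation.countable_reflTransGen {α : Type*} {r : α → α → Prop}
    (h : ∀ x, {y | r x y}.Countable) (x : α) : {y | Relation.ReflTransGen r x y}.Countable := by
  -- `A n` is the set of points reached in exactly `n` steps.
  let A : ℕ → Set α := fun n => Nat.rec {x} (fun _ s => ⋃ y ∈ s, {z | r y z}) n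
  have hA : ∀ n, (A n).Countable := by
    intro n
    induction n with
    | zero => exact Set.countable_singleton x
    | succ n ih => exact ih.biUnion fun y _ => h y
  refine (Set.countable_iUnion hA).mono fun y hy => ?_
  induction hy with
  | refl => exact Set.mem_iUnion.2 ⟨0, rfl⟩
  | @tail y z _ hyz ih =>
    obtain ⟨n, hn⟩ := Set.mem_iUnion.1 ih
    exact Set.mem_iUnion.2 ⟨n + 1, Set.mem_biUnion hn hyz⟩

/-- A program has only countably many symbolic paths. -/
theorem countable_isSymPath (P : Program F) :
    {p : Tm F SymLit [] Ty.real × SymState F | IsSymPath P p.1 p.2}.Countable := by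
  refine (Relation.countable_reflTransGen (fun c => ?_)
    (P.mapLit SymLit.const, (⟨0, [], []⟩ : SymState F))).mono fun p hp => hp.2
  refine Set.Countable.mono (s₂ := ⋃ b : Bool, {c' : Tm F SymLit [] Ty.real × SymState F |
    CtxClosure (fun _ => IsSymVal) (SymRedexOn b) c.1 c.2 c'.1 c'.2}) (fun c' hc' => ?_)
    (Set.countable_iUnion fun b => Set.Subsingleton.countable fun x hx y hy => ?_)
  · exact Set.mem_iUnion.2 (exists_symRedexOn hc')
  · obtain ⟨h1, h2⟩ := (symRedexSystem b).unique hx hy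
    exact Prod.ext h1 h2

/-! ### Well-definedness of values and weights -/

theorem Evaluates.unique {P : Program F} {s : List unitInterval} {r r' : ℝ} {w w' : ℝ≥0}
    (h : Evaluates P s r w) (h' : Evaluates P s r' w') : r = r' ∧ w = w' := by
  have := redexSystem.unique_value h h' (.lit _) (.lit _)
  simpa using this

theorem IntervalEvaluates.unique {P : Program F} {t : IntervalTrace} {I I' w w' : Interval}
    (h : IntervalEvaluates P t I w) (h' : IntervalEvaluates P t I' w') : I = I' ∧ w = w' := by
  have := intervalRedexSystem.unique_value h h' (.lit _) (.lit _)
  simpa using this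

theorem weight_eq {P : Program F} {s : Trace} {r : ℝ} {w : ℝ≥0}
    (h : Evaluates P s.toList r w) : weight P s = w := by
  have hex : ∃ w, ∃ r, Evaluates P s.toList r w := ⟨w, r, h⟩
  rw [weight, dif_pos hex]
  obtain ⟨r', hr'⟩ := hex.choose_spec
  exact (hr'.unique h).2

theorem intervalWeight_eq {P : Program F} {t : IntervalTrace} {I w : Interval}
    (h : IntervalEvaluates P t I w) : intervalWeight P t = w := by
  have hex : ∃ w, ∃ I, IntervalEvaluates P t I w := ⟨w, I, h⟩
  rw [intervalWeight, dif_pos hex]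
  obtain ⟨r', hr'⟩ := hex.choose_spec
  exact (hr'.unique h).2

theorem intervalValue_eq {P : Program F} {t : IntervalTrace} {I w : Interval}
    (h : IntervalEvaluates P t I w) : intervalValue P t = I := by
  have hex : ∃ I, ∃ w, IntervalEvaluates P t I w := ⟨I, w, h⟩
  rw [intervalValue, dif_pos hex]
  obtain ⟨r', hr'⟩ := hex.choose_spec
  exact (hr'.unique h).1

/-- A terminating interval trace has no proper terminating extension. -/
theorem IntervalEvaluates.eq_nil_of_append {P : Program F} {t u : IntervalTrace}
    {I I' w w' : Interval} (h : IntervalEvaluates P t I w)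
    (h' : IntervalEvaluates P (t ++ u) I' w') : u = [] := by
  -- No rule looks beyond the head of the trace, so the run on `t` lifts to `t ++ u` and leaves `u`
  -- unread; by uniqueness of the normal form this rest is empty.
  have hu : Reduces (fun _ => IsVal) IntervalRedex
      (P.mapLit Interval.point, (t ++ u, Interval.point 1)) (lit I, ([] ++ u, w)) := by
    refine Relation.ReflTransGen.lift
      (fun c : Tm F Interval [] Ty.real × IntervalTrace × Interval =>
        (c.1, (c.2.1 ++ u, c.2.2))) (fun c c' hc => ?_) _ _ h
    refine CtxClosure.mono
      (φ := fun σ : IntervalTrace × Interval => (σ.1 ++ u, σ.2)) (fun a M s M' s' hr => ?_) hc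
    cases hr with
    | beta M t w h => exact .beta M _ _ h
    | fix M t w h => exact .fix M _ _ h
    | sample I t w => exact .sample I _ _
    | prim f hf args B t w h => exact .prim f hf args B _ _ h
    | iteLeft _ _ _ _ h => exact .iteLeft _ _ _ _ h
    | iteRight _ _ _ _ h => exact .iteRight _ _ _ _ h
    | score t w h => exact .score _ _ h
  have := intervalRedexSystem.unique_value hu h' (.lit _) (.lit _)
  simp only [Prod.mk.injEq] at this
  simpa using this.2.1

/-! ### Simulation of terms -/

/-- Two terms have the same shape, their literals being related by `ℓ`, except that a primitive
function applied to terms related to literals may correspond to a literal, as allowed by `κ`. -/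
inductive Sim {L L' : Type} (ℓ : L → L' → Prop)
    (κ : ∀ n : ℕ, ((Fin n → ℝ) → ℝ) → (Fin n → L') → L' → Prop) :
    ∀ {Γ : List Ty} {a : Ty}, Tm F L Γ a → Tm F L' Γ a → Prop
  | var {Γ : List Ty} {a : Ty} (v : Var Γ a) : Sim ℓ κ (var v) (var v)
  | lit {Γ : List Ty} {x : L} {y : L'} : ℓ x y →
      Sim ℓ κ (lit x : Tm F L Γ Ty.real) (lit y)
  | lam {Γ : List Ty} {a b : Ty} {M : Tm F L (a :: Γ) b} {N : Tm F L' (a :: Γ) b} :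
      Sim ℓ κ M N → Sim ℓ κ (lam M) (lam N)
  | fix {Γ : List Ty} {a b : Ty} {M : Tm F L (a :: Ty.arr a b :: Γ) b}
      {N : Tm F L' (a :: Ty.arr a b :: Γ) b} : Sim ℓ κ M N → Sim ℓ κ (fix M) (fix N)
  | app {Γ : List Ty} {a b : Ty} {M : Tm F L Γ (Ty.arr a b)} {N : Tm F L' Γ (Ty.arr a b)}
      {M' : Tm F L Γ a} {N' : Tm F L' Γ a} :
      Sim ℓ κ M N → Sim ℓ κ M' N' → Sim ℓ κ (app M M') (app N N')
  | ite {Γ : List Ty} {a : Ty} {M : Tm F L Γ Ty.real} {N : Tm F L' Γ Ty.real}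
      {M₁ M₂ : Tm F L Γ a} {N₁ N₂ : Tm F L' Γ a} :
      Sim ℓ κ M N → Sim ℓ κ M₁ N₁ → Sim ℓ κ M₂ N₂ → Sim ℓ κ (ite M M₁ M₂) (ite N N₁ N₂)
  | prim {Γ : List Ty} {n : ℕ} (f : (Fin n → ℝ) → ℝ) (hf : f ∈ F n)
      {args : Fin n → Tm F L Γ Ty.real} {args' : Fin n → Tm F L' Γ Ty.real} :
      (∀ i, Sim ℓ κ (args i) (args' i)) → Sim ℓ κ (prim f hf args) (prim f hf args')
  | sample {Γ : List Ty} : Sim ℓ κ (sample : Tm F L Γ Ty.real) sample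
  | score {Γ : List Ty} {M : Tm F L Γ Ty.real} {N : Tm F L' Γ Ty.real} :
      Sim ℓ κ M N → Sim ℓ κ (score M) (score N)
  | collapse {Γ : List Ty} {n : ℕ} (f : (Fin n → ℝ) → ℝ) (hf : f ∈ F n)
      {args : Fin n → Tm F L Γ Ty.real} {r : Fin n → L'} {y : L'} :
      (∀ i, Sim ℓ κ (args i) (lit (r i))) → κ n f r y → Sim ℓ κ (prim f hf args) (lit y)

namespace Sim

variable {L L' : Type} {ℓ : L → L' → Prop}
  {κ : ∀ n : ℕ, ((Fin n → ℝ) → ℝ) → (Fin n → L') → L' → Prop}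

theorem rename {Γ Δ : List Ty} {a : Ty} {M : Tm F L Γ a} {N : Tm F L' Γ a} (h : Sim ℓ κ M N)
    (ρ : ∀ b, Var Γ b → Var Δ b) : Sim ℓ κ (M.rename ρ) (N.rename ρ) := by
  induction h generalizing Δ with
  | var v => exact .var _
  | lit h => exact .lit h
  | lam _ ih => exact .lam (ih _)
  | fix _ ih => exact .fix (ih _)
  | app _ _ ih ih' => exact .app (ih _) (ih' _)
  | ite _ _ _ ih ih₁ ih₂ => exact .ite (ih _) (ih₁ _) (ih₂ _)
  | prim f hf _ ih => exact .prim f hf fun i => ih i _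
  | sample => exact .sample
  | score _ ih => exact .score (ih _)
  | collapse f hf _ hκ ih => exact .collapse f hf (fun i => ih i _) hκ

theorem liftSub {Γ Δ : List Ty} {σ : ∀ b, Var Γ b → Tm F L Δ b}
    {τ : ∀ b, Var Γ b → Tm F L' Δ b} (h : ∀ b v, Sim ℓ κ (σ b v) (τ b v)) (c : Ty) :
    ∀ b v, Sim ℓ κ (Tm.liftSub σ c b v) (Tm.liftSub τ c b v)
  | _, Var.zero => .var _
  | _, Var.succ v => (h _ v).rename _

theorem subst {Γ Δ : List Ty} {a : Ty} {M : Tm F L Γ a} {N : Tm F L' Γ a} (h : Sim ℓ κ M N)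
    {σ : ∀ b, Var Γ b → Tm F L Δ b} {τ : ∀ b, Var Γ b → Tm F L' Δ b}
    (hσ : ∀ b v, Sim ℓ κ (σ b v) (τ b v)) : Sim ℓ κ (M.subst σ) (N.subst τ) := by
  induction h generalizing Δ with
  | var v => exact hσ _ v
  | lit h => exact .lit h
  | lam _ ih => exact .lam (ih (liftSub hσ _))
  | fix _ ih => exact .fix (ih (liftSub (liftSub hσ _) _))
  | app _ _ ih ih' => exact .app (ih hσ) (ih' hσ)
  | ite _ _ _ ih ih₁ ih₂ => exact .ite (ih hσ) (ih₁ hσ) (ih₂ hσ)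
  | prim f hf _ ih => exact .prim f hf fun i => ih i hσ
  | sample => exact .sample
  | score _ ih => exact .score (ih hσ)
  | collapse f hf _ hκ ih => exact .collapse f hf (fun i => ih i hσ) hκ

theorem consSub {Γ Δ : List Ty} {c : Ty} {V : Tm F L Δ c} {W : Tm F L' Δ c} (hV : Sim ℓ κ V W)
    {σ : ∀ b, Var Γ b → Tm F L Δ b} {τ : ∀ b, Var Γ b → Tm F L' Δ b}
    (h : ∀ b v, Sim ℓ κ (σ b v) (τ b v)) :
    ∀ b v, Sim ℓ κ (Tm.consSub V σ b v) (Tm.consSub W τ b v)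
  | _, Var.zero => hV
  | _, Var.succ v => h _ v

theorem inst {Γ : List Ty} {a b : Ty} {M : Tm F L (a :: Γ) b} {N : Tm F L' (a :: Γ) b}
    {V : Tm F L Γ a} {W : Tm F L' Γ a} (h : Sim ℓ κ M N) (hV : Sim ℓ κ V W) :
    Sim ℓ κ (M.inst V) (N.inst W) :=
  h.subst (consSub hV fun _ v => .var v)

theorem inst₂ {Γ : List Ty} {a b c : Ty} {M : Tm F L (a :: c :: Γ) b}
    {N : Tm F L' (a :: c :: Γ) b} {V : Tm F L Γ a} {W : Tm F L' Γ a} {V' : Tm F L Γ c}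
    {W' : Tm F L' Γ c} (h : Sim ℓ κ M N) (hV : Sim ℓ κ V W) (hV' : Sim ℓ κ V' W') :
    Sim ℓ κ (M.inst₂ V V') (N.inst₂ W W') :=
  h.subst (consSub hV (consSub hV' fun _ v => .var v))

theorem mapLit {L₀ : Type} {g : L₀ → L} {h : L₀ → L'} (hgh : ∀ r, ℓ (g r) (h r)) {Γ : List Ty}
    {a : Ty} (M : Tm F L₀ Γ a) : Sim ℓ κ (M.mapLit g) (M.mapLit h) := by
  induction M with
  | var v => exact .var v
  | lit r => exact .lit (hgh r)
  | lam _ ih => exact .lam ih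
  | fix _ ih => exact .fix ih
  | app _ _ ih ih' => exact .app ih ih'
  | ite _ _ _ ih ih₁ ih₂ => exact .ite ih ih₁ ih₂
  | prim f hf _ ih => exact .prim f hf ih
  | sample => exact .sample
  | score _ ih => exact .score ih

/-- A literal on the right may stand for an unevaluated primitive application on the left, so only
`IsSymVal` can be expected there. -/
theorem isSymVal {Γ : List Ty} {a : Ty} {M : Tm F L Γ a} {N : Tm F L' Γ a} (h : Sim ℓ κ M N)
    (hN : IsVal N) : IsSymVal M := by
  induction h with
  | var v => exact .var v
  | lit h => exact .lit _
  | lam _ ih => exact .lam _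
  | fix _ ih => exact .fix _
  | app => cases hN
  | ite => cases hN
  | prim => cases hN
  | sample => cases hN
  | score => cases hN
  | collapse f hf _ _ ih => exact .prim f hf _ fun i => ih i (.lit _)

theorem isVal {Γ : List Ty} {a : Ty} {M : Tm F L Γ a} {N : Tm F L' Γ a} (h : Sim ℓ κ M N)
    (hM : IsVal M) : IsVal N := by
  cases hM with
  | var => cases h; exact .var _
  | lit => cases h; exact .lit _
  | lam => cases h; exact .lam _
  | fix => cases h; exact .fix _

end Sim

@[simp]
theorem Tm.mapLit_id {L : Type} {Γ : List Ty} {a : Ty} (M : Tm F L Γ a) : M.mapLit id = M := by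
  induction M <;> simp_all [Tm.mapLit]

/-! ### Evaluation of symbolic values -/

/-- A domain of literals that interprets real constants and primitive functions. -/
structure Interp (L : Type) where
  const : ℝ → L
  ap : ∀ n : ℕ, ((Fin n → ℝ) → ℝ) → (Fin n → L) → L

/-- The interpretation by real numbers. -/
def realInterp : Interp ℝ := ⟨id, fun _ f r => f r⟩

/-- The interpretation by intervals. -/
noncomputable def intervalInterp : Interp Interval := ⟨Interval.point, fun _ f B => liftFun f B⟩

namespace Interp

variable {L : Type} (A : Interp L)

/-- The assignment of the entries of a trace to the sample variables. -/
def env (l : List L) : ℕ → L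
  -- Sample variables are numbered from `1`; index `0` and indices beyond the trace receive a
  -- default value.
  | 0 => A.const 0
  | j + 1 => l.getD j (A.const 0)

/-- The interpretation of symbolic literals on a trace. -/
def litEval (l : List L) : SymLit → L
  | .const r => A.const r
  | .sampleVar j => A.env l j

/-- The interpretation of symbolic values on a trace; other terms are interpreted by `0`. -/
def eval (l : List L) : ∀ {Γ : List Ty} {a : Ty}, Tm F SymLit Γ a → L
  | _, _, Tm.lit x => A.litEval l x
  | _, _, Tm.prim f _ args => A.ap _ f fun i => eval l (args i)
  | _, _, Tm.var _ => A.const 0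
  | _, _, Tm.lam _ => A.const 0
  | _, _, Tm.fix _ => A.const 0
  | _, _, Tm.app _ _ => A.const 0
  | _, _, Tm.ite _ _ _ => A.const 0
  | _, _, Tm.sample => A.const 0
  | _, _, Tm.score _ => A.const 0

/-- The relation between symbolic terms and their instances on a trace, in which some of the
symbolic values have been evaluated. -/
abbrev Inst (l : List L) {Γ : List Ty} {a : Ty} : Tm F SymLit Γ a → Tm F L Γ a → Prop :=
  Sim (fun x y => y = A.litEval l x) (fun n f r y => y = A.ap n f r)

variable {A}

theorem Inst.eq_eval {l : List L} {Γ : List Ty} {W : Tm F SymLit Γ Ty.real} {y : L}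
    (h : A.Inst l W (lit y)) : y = A.eval l W := by
  -- The type and the right-hand term are generalised to allow induction on `Inst`; the
  -- heterogeneous equation remembers that the term is a literal.
  suffices H : ∀ {Γ : List Ty} {a : Ty} {W : Tm F SymLit Γ a} {N : Tm F L Γ a}, A.Inst l W N →
      ∀ y, HEq N (lit y : Tm F L Γ Ty.real) → a = Ty.real → y = A.eval l W from
    H h y HEq.rfl rfl
  intro Γ a W N h
  induction h with
  | lit h => intro y hy _; cases hy; exact h
  | collapse f hf _ hκ ih =>
    intro y hy _
    cases hy
    rw [hκ, eval]
    exact congrArg _ (funext fun i => ih i _ HEq.rfl rfl)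
  | var => intro y hy ha; subst ha; cases hy
  | lam => intro y hy ha; cases ha
  | fix => intro y hy ha; cases ha
  | app => intro y hy ha; subst ha; cases hy
  | ite => intro y hy ha; subst ha; cases hy
  | prim => intro y hy ha; cases hy
  | sample => intro y hy ha; cases hy
  | score => intro y hy ha; cases hy

end Interp

/-- The constraint holds for all values in an interval. -/
def SymConstraint.Holds (C : SymConstraint F) (J : Interval) : Prop :=
  match C.rel with
  | .le => J.hi ≤ C.bound
  | .lt => J.hi < C.bound
  | .ge => (C.bound : EReal) ≤ J.lo
  | .gt => (C.bound : EReal) < J.lo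

/-! ### Concrete runs follow symbolic paths -/

/-- The list of real entries of a concrete trace. -/
def realTrace (s : List unitInterval) : List ℝ := s.map (↑)

/-- The product of the scores on a concrete trace. -/
noncomputable def scoreProd (s : List unitInterval) (Ξ : List (Tm F SymLit [] Ty.real)) : ℝ≥0 :=
  (Ξ.map fun W => (realInterp.eval (realTrace s) W).toNNReal).prod

/-- A symbolic state describes the state of a concrete run on the trace `s`. -/
structure StateInst (s : List unitInterval) (q : SymState F) (σ : List unitInterval × ℝ≥0) :
    Prop where
  le_length : q.numSamples ≤ s.length
  trace : σ.1 = s.drop q.numSamples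
  weight : σ.2 = scoreProd s q.scores
  constraints : ∀ C ∈ q.constraints, C.Holds (.point (realInterp.eval (realTrace s) C.term))
  scores : ∀ W ∈ q.scores, 0 ≤ realInterp.eval (realTrace s) W

/-- Evaluation of a primitive function has no symbolic counterpart: it only collapses an application
in the relation `Inst`, which accounts for the alternative without a step. Every other rule is
matched by one symbolic step. -/
theorem exists_symbolic_step {s : List unitInterval} {a : Ty} {M M' : Tm F ℝ [] a}
    {σ σ' : List unitInterval × ℝ≥0} (h : CtxClosure (fun _ => IsVal) Redex M σ M' σ')
    {X : Tm F SymLit [] a} {q : SymState F} (hX : realInterp.Inst (realTrace s) X M)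
    (hq : StateInst s q σ) :
    ∃ X' q', ((X' = X ∧ q' = q) ∨ CtxClosure (fun _ => IsSymVal) SymRedex X q X' q') ∧
      realInterp.Inst (realTrace s) X' M' ∧ StateInst s q' σ' := by
  induction h generalizing q with
  | redex hr =>
    obtain ⟨n, Δ, Ξ⟩ := q
    cases hr with
    | beta M t w hV =>
      cases hX with
      | app hL hX =>
        cases hL with
        | lam hL => exact ⟨_, _, .inr (.redex (.beta _ _ (hX.isSymVal hV))), hL.inst hX, hq⟩
    | fix M t w hV =>
      cases hX with
      | app hL hX =>
        cases hL with
        | fix hL =>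
          exact ⟨_, _, .inr (.redex (.fix _ _ (hX.isSymVal hV))), hL.inst₂ hX (.fix hL), hq⟩
    | sample r t w =>
      cases hX
      have htr : r :: t = s.drop n := hq.trace
      have hn : n < s.length := by
        by_contra hn
        rw [List.drop_eq_nil_of_le (not_lt.1 hn)] at htr
        cases htr
      rw [List.drop_eq_getElem_cons hn] at htr
      injection htr with h1 h2
      refine ⟨_, _, .inr (.redex (.sample n Δ Ξ)), .lit ?_, hn, h2, hq.weight, hq.constraints,
        hq.scores⟩
      simp [Interp.litEval, Interp.env, realTrace, hn, h1]
    | prim f hf args r t w hr =>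
      cases hX with
      | prim _ _ hX =>
        exact ⟨_, _, .inl ⟨rfl, rfl⟩, .collapse f hf (fun i => hr i ▸ hX i) rfl, hq⟩
    | iteLeft _ _ t w hr =>
      cases hX with
      | ite hG hN hP =>
        refine ⟨_, _, .inr (.redex (.iteLeft _ _ _ _ _ (hG.isSymVal (.lit _)))), hN,
          hq.le_length, hq.trace, hq.weight, List.forall_mem_cons.2 ⟨?_, hq.constraints⟩,
          hq.scores⟩
        rw [← Interp.Inst.eq_eval hG]
        exact EReal.coe_le_coe_iff.2 hr
    | iteRight _ _ t w hr =>
      cases hX with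
      | ite hG hN hP =>
        refine ⟨_, _, .inr (.redex (.iteRight _ _ _ _ _ (hG.isSymVal (.lit _)))), hP,
          hq.le_length, hq.trace, hq.weight, List.forall_mem_cons.2 ⟨?_, hq.constraints⟩,
          hq.scores⟩
        rw [← Interp.Inst.eq_eval hG]
        exact EReal.coe_lt_coe_iff.2 hr
    | score t w hr =>
      cases hX with
      | score hG =>
        have he := Interp.Inst.eq_eval hG
        refine ⟨_, _, .inr (.redex (.score _ _ _ (hG.isSymVal (.lit _)))), hG,
          hq.le_length, hq.trace, ?_, List.forall_mem_cons.2 ⟨?_, hq.constraints⟩,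
          List.forall_mem_cons.2 ⟨he ▸ hr, hq.scores⟩⟩
        · have := hq.weight
          simp only [scoreProd, List.map_cons, List.prod_cons] at this ⊢
          rw [this, ← he, mul_comm]
        · rw [← he]
          exact EReal.coe_le_coe_iff.2 hr
  | appLeft N _ ih =>
    cases hX with
    | app hM hN =>
      obtain ⟨X', q', hs, hX', hq'⟩ := ih hM hq
      refine ⟨_, q', ?_, .app hX' hN, hq'⟩
      rcases hs with ⟨rfl, rfl⟩ | hs
      · exact .inl ⟨rfl, rfl⟩
      · exact .inr (.appLeft _ hs)
  | appRight hv _ ih =>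
    cases hX with
    | app hM hN =>
      obtain ⟨X', q', hs, hX', hq'⟩ := ih hN hq
      refine ⟨_, q', ?_, .app hM hX', hq'⟩
      rcases hs with ⟨rfl, rfl⟩ | hs
      · exact .inl ⟨rfl, rfl⟩
      · exact .inr (.appRight (hM.isSymVal hv) hs)
  | ite N P _ ih =>
    cases hX with
    | ite hM hN hP =>
      obtain ⟨X', q', hs, hX', hq'⟩ := ih hM hq
      refine ⟨_, q', ?_, .ite hX' hN hP, hq'⟩
      rcases hs with ⟨rfl, rfl⟩ | hs
      · exact .inl ⟨rfl, rfl⟩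
      · exact .inr (.ite _ _ hs)
  | prim f hf args i hv _ ih =>
    cases hX with
    | @prim _ _ _ _ xs _ hM =>
      obtain ⟨X', q', hs, hX', hq'⟩ := ih (hM i) hq
      refine ⟨Tm.prim f hf (Function.update xs i X'), q', ?_, .prim f hf fun j => ?_, hq'⟩
      · rcases hs with ⟨rfl, rfl⟩ | hs
        · exact .inl ⟨by rw [Function.update_eq_self], rfl⟩
        · exact .inr (.prim f hf xs i (fun j hj => (hM j).isSymVal (hv j hj)) hs)
      · by_cases hj : j = i
        · subst hj; simpa using hX'
        · simpa [hj] using hM j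
  | score _ ih =>
    cases hX with
    | score hM =>
      obtain ⟨X', q', hs, hX', hq'⟩ := ih hM hq
      refine ⟨_, q', ?_, .score hX', hq'⟩
      rcases hs with ⟨rfl, rfl⟩ | hs
      · exact .inl ⟨rfl, rfl⟩
      · exact .inr (.score hs)

/-- A terminating run follows a symbolic path. -/
theorem Evaluates.exists_isSymPath {P : Program F} {s : List unitInterval} {r : ℝ} {w : ℝ≥0}
    (h : Evaluates P s r w) :
    ∃ V q, IsSymPath P V q ∧ q.numSamples = s.length ∧ r = realInterp.eval (realTrace s) V ∧
      w = scoreProd s q.scores ∧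
      (∀ C ∈ q.constraints, C.Holds (.point (realInterp.eval (realTrace s) C.term))) ∧
      ∀ W ∈ q.scores, 0 ≤ realInterp.eval (realTrace s) W := by
  have key : ∀ c, Reduces (fun _ => IsVal) Redex (P, (s, 1)) c → ∃ X q,
      Reduces (fun _ => IsSymVal) SymRedex (P.mapLit SymLit.const, ⟨0, [], []⟩) (X, q) ∧
        realInterp.Inst (realTrace s) X c.1 ∧ StateInst s q c.2 := by
    intro c hc
    induction hc with
    | refl =>
      refine ⟨_, _, .refl, ?_, Nat.zero_le _, rfl, rfl, by simp, by simp⟩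
      simpa using Sim.mapLit (g := SymLit.const) (h := id) (ℓ := fun x y => y =
        realInterp.litEval (realTrace s) x) (fun r => rfl) P
    | tail _ hs ih =>
      obtain ⟨X, q, hr, hX, hq⟩ := ih
      obtain ⟨X', q', hs', hX', hq'⟩ := exists_symbolic_step hs hX hq
      refine ⟨X', q', ?_, hX', hq'⟩
      rcases hs' with ⟨rfl, rfl⟩ | hs'
      · exact hr
      · exact hr.tail hs'
  obtain ⟨V, q, hr, hV, hq⟩ := key _ h
  refine ⟨V, q, ⟨hV.isSymVal (.lit _), hr⟩, le_antisymm hq.le_length ?_, hV.eq_eval, hq.weight,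
    hq.constraints, hq.scores⟩
  -- The run ends with the empty trace, so every entry has been drawn.
  exact List.drop_eq_nil_iff.1 hq.trace.symm

/-! ### Many-step reduction in contexts -/

namespace Tm

variable {L : Type} {S : Type} {val : ∀ a, Tm F L [] a → Prop}
  {red : ∀ a, Tm F L [] a → S → Tm F L [] a → S → Prop}

/-- Many-step reduction of closed terms of arbitrary type. -/
def Steps (val : ∀ a, Tm F L [] a → Prop) (red : ∀ a, Tm F L [] a → S → Tm F L [] a → S → Prop)
    {a : Ty} : Tm F L [] a × S → Tm F L [] a × S → Prop :=
  Relation.ReflTransGen fun c c' => CtxClosure val red c.1 c.2 c'.1 c'.2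

theorem Steps.lift {a b : Ty} (E : Tm F L [] a → Tm F L [] b)
    (hE : ∀ {M s M' s'}, CtxClosure val red M s M' s' → CtxClosure val red (E M) s (E M') s')
    {M M' : Tm F L [] a} {s s' : S} (h : Steps val red (M, s) (M', s')) :
    Steps val red (E M, s) (E M', s') :=
  Relation.ReflTransGen.lift (fun c : Tm F L [] a × S => (E c.1, c.2)) (fun _ _ hc => hE hc) _ _ h

theorem Steps.prim {n : ℕ} (f : (Fin n → ℝ) → ℝ) (hf : f ∈ F n) (args : Fin n → Tm F L [] Ty.real)
    (i : Fin n) {M' : Tm F L [] Ty.real} {s s' : S} (hv : ∀ j, j < i → val Ty.real (args j))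
    (h : Steps val red (args i, s) (M', s')) :
    Steps val red (Tm.prim f hf args, s) (Tm.prim f hf (Function.update args i M'), s') := by
  have := h.lift (b := Ty.real) (fun X => Tm.prim f hf (Function.update args i X)) (by
    intro M s M' s' hs
    have := CtxClosure.prim (val := val) (red := red) (s := s) (s' := s') (M' := M') f hf
      (Function.update args i M) i
      (fun j hj => by rw [Function.update_of_ne hj.ne]; exact hv j hj) (by simpa using hs)
    simpa using this)
  simpa using this

/-- Evaluation of the first `k` arguments of a primitive function. -/
theorem Steps.prim_prefix {n : ℕ} (f : (Fin n → ℝ) → ℝ) (hf : f ∈ F n)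
    (args vals : Fin n → Tm F L [] Ty.real) (s : S) (k : ℕ) (hk : k ≤ n)
    (h : ∀ j : Fin n, (j : ℕ) < k → val _ (vals j) ∧ Steps val red (args j, s) (vals j, s)) :
    Steps val red (Tm.prim f hf args, s)
      (Tm.prim f hf (fun j => if (j : ℕ) < k then vals j else args j), s) := by
  induction k with
  | zero =>
    simp only [Nat.not_lt_zero, if_false]
    exact .refl
  | succ k ih =>
    refine (ih (by omega) fun j hj => h j (by omega)).trans ?_
    have h' := h ⟨k, hk⟩ (Nat.lt_succ_self k)
    have := Steps.prim (val := val) (red := red) f hf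
      (fun j : Fin n => if (j : ℕ) < k then vals j else args j) ⟨k, hk⟩
      (fun j hj => by
        have hj : (j : ℕ) < k := hj
        simpa [hj] using (h j (by omega)).1) (by simpa using h'.2)
    suffices he : (fun j : Fin n => if (j : ℕ) < k + 1 then vals j else args j) =
        Function.update (fun j : Fin n => if (j : ℕ) < k then vals j else args j) ⟨k, hk⟩
          (vals ⟨k, hk⟩) by
      rw [he]; exact this
    funext j
    rcases lt_trichotomy (j : ℕ) k with hj | hj | hj
    · rw [Function.update_of_ne (by rintro rfl; simp at hj), if_pos hj, if_pos (by omega)]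
    · obtain rfl : j = ⟨k, hk⟩ := Fin.ext hj
      simp
    · rw [Function.update_of_ne (by rintro rfl; simp at hj), if_neg (by omega),
        if_neg (by omega)]

end Tm

theorem exists_lit_of_isVal {L : Type} {V : Tm F L [] Ty.real} (h : IsVal V) :
    ∃ y, V = lit y := by
  cases h with
  | var v => cases v
  | lit r => exact ⟨r, rfl⟩

/-! ### Symbolic paths give rise to interval runs -/

/-- The list of intervals of an interval trace. -/
def intervals (t : IntervalTrace) : List Interval := t.map Subtype.val

/-- The interval weight obtained from a list of scores. -/
noncomputable def intervalScore (t : IntervalTrace) (Ξ : List (Tm F SymLit [] Ty.real)) :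
    Interval :=
  Ξ.foldr (fun W w => w.mul (intervalInterp.eval (intervals t) W)) (.point 1)

/-- An instance of a symbolic value may still contain unevaluated primitive applications. Evaluating
them touches neither trace nor weight, whence the arbitrary state `σ`. The context is a variable for
the sake of the induction on `IsSymVal`. -/
theorem exists_interval_value_aux {t : IntervalTrace} {Γ : List Ty} {a : Ty}
    {X : Tm F SymLit Γ a} (hX : IsSymVal X) (hΓ : Γ = []) {M : Tm F Interval Γ a}
    (hM : intervalInterp.Inst (intervals t) X M) :
    ∃ V, IsVal V ∧ intervalInterp.Inst (intervals t) X V ∧ ∀ σ,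
      Steps (fun _ => IsVal) IntervalRedex (hΓ ▸ M, σ) (hΓ ▸ V, σ) := by
  induction hX with
  | var v => subst hΓ; cases v
  | lit => cases hM; exact ⟨_, .lit _, .lit ‹_›, fun _ => .refl⟩
  | lam => cases hM; exact ⟨_, .lam _, .lam ‹_›, fun _ => .refl⟩
  | fix => cases hM; exact ⟨_, .fix _, .fix ‹_›, fun _ => .refl⟩
  | @prim n f hf args _ ih =>
    subst hΓ
    cases hM with
    | collapse _ _ h hκ => exact ⟨_, .lit _, .collapse f hf h hκ, fun _ => .refl⟩
    | @prim _ _ _ _ _ args' h =>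
      choose V hV hXV hs using fun i => ih i (h i)
      choose y hy using fun i => exists_lit_of_isVal (hV i)
      refine ⟨lit (liftFun f y), .lit _, .collapse f hf (r := y) (fun i => hy i ▸ hXV i) rfl,
        fun σ => ?_⟩
      refine Relation.ReflTransGen.tail
        (Steps.prim_prefix f hf args' V σ n le_rfl fun j _ => ⟨hV j, hs j σ⟩) (.redex ?_)
      exact .prim f hf _ y σ.1 σ.2 fun i => by simp [hy i]

theorem exists_interval_value {t : IntervalTrace} {a : Ty} {X : Tm F SymLit [] a}
    (hX : IsSymVal X) {M : Tm F Interval [] a} (hM : intervalInterp.Inst (intervals t) X M) :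
    ∃ V, IsVal V ∧ intervalInterp.Inst (intervals t) X V ∧ ∀ σ,
      Steps (fun _ => IsVal) IntervalRedex (M, σ) (V, σ) :=
  exists_interval_value_aux hX rfl hM

theorem exists_interval_lit {t : IntervalTrace} {X : Tm F SymLit [] Ty.real}
    (hX : IsSymVal X) {M : Tm F Interval [] Ty.real}
    (hM : intervalInterp.Inst (intervals t) X M) (σ : IntervalTrace × Interval) :
    intervalInterp.Inst (intervals t) X (lit (intervalInterp.eval (intervals t) X)) ∧
      Steps (fun _ => IsVal) IntervalRedex (M, σ)
        (lit (intervalInterp.eval (intervals t) X), σ) := by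
  obtain ⟨V, hV, hXV, hs⟩ := exists_interval_value hX hM
  obtain ⟨y, rfl⟩ := exists_lit_of_isVal hV
  obtain rfl := Interp.Inst.eq_eval hXV
  exact ⟨hXV, hs σ⟩

/-- Symbolic execution delays primitive functions, so the interval run must catch up whenever a
value is needed, and one symbolic step becomes several. The constraints recorded up to and including
this step are exactly what unblocks `ite` and `score`. -/
theorem exists_interval_steps {t : IntervalTrace} {a : Ty} {X X' : Tm F SymLit [] a}
    {q q' : SymState F} (h : CtxClosure (fun _ => IsSymVal) SymRedex X q X' q')
    {M : Tm F Interval [] a} (hX : intervalInterp.Inst (intervals t) X M)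
    (hn : q'.numSamples ≤ t.length)
    (hC : ∀ C ∈ q'.constraints, C.Holds (intervalInterp.eval (intervals t) C.term)) :
    ∃ M', intervalInterp.Inst (intervals t) X' M' ∧
      Steps (fun _ => IsVal) IntervalRedex
        (M, (t.drop q.numSamples, intervalScore t q.scores))
        (M', (t.drop q'.numSamples, intervalScore t q'.scores)) := by
  induction h with
  | redex hr =>
    cases hr with
    | beta K _ hV =>
      cases hX with
      | app hL hX =>
        cases hL with
        | lam hL =>
          obtain ⟨V', hV', hXV, hs⟩ := exists_interval_value hV hX
          exact ⟨_, hL.inst hXV, ((hs _).lift (Tm.app _) (.appRight (.lam _))).tail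
            (.redex (.beta _ _ _ hV'))⟩
    | fix K _ hV =>
      cases hX with
      | app hL hX =>
        cases hL with
        | fix hL =>
          obtain ⟨V', hV', hXV, hs⟩ := exists_interval_value hV hX
          exact ⟨_, hL.inst₂ hXV (.fix hL), ((hs _).lift (Tm.app _) (.appRight (.fix _))).tail
            (.redex (.fix _ _ _ hV'))⟩
    | sample n Δ Ξ =>
      cases hX
      have hn : n < t.length := hn
      refine ⟨lit (t[n] : UnitSubinterval).1, .lit ?_, .single (.redex ?_)⟩
      · simp [Interp.litEval, Interp.env, intervals, hn]
      · simp only [List.drop_eq_getElem_cons hn]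
        exact .sample _ _ _
    | iteLeft N P n Δ Ξ hV =>
      cases hX with
      | ite hG hN hP =>
        obtain ⟨-, hs⟩ := exists_interval_lit hV hG (t.drop n, intervalScore t Ξ)
        refine ⟨_, hN, (hs.lift (fun G => Tm.ite G _ _) (.ite _ _)).tail
          (.redex (.iteLeft _ _ _ _ ?_))⟩
        exact hC _ (List.mem_cons_self)
    | iteRight N P n Δ Ξ hV =>
      cases hX with
      | ite hG hN hP =>
        obtain ⟨-, hs⟩ := exists_interval_lit hV hG (t.drop n, intervalScore t Ξ)
        refine ⟨_, hP, (hs.lift (fun G => Tm.ite G _ _) (.ite _ _)).tail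
          (.redex (.iteRight _ _ _ _ ?_))⟩
        exact hC _ (List.mem_cons_self)
    | score n Δ Ξ hV =>
      cases hX with
      | score hG =>
        obtain ⟨hI, hs⟩ := exists_interval_lit hV hG (t.drop n, intervalScore t Ξ)
        refine ⟨_, hI, (hs.lift Tm.score .score).tail (.redex (.score _ _ ?_))⟩
        exact hC _ (List.mem_cons_self)
  | appLeft N _ ih =>
    cases hX with
    | app hM hN =>
      obtain ⟨M', hM', hs⟩ := ih hM hn hC
      exact ⟨_, .app hM' hN, hs.lift (fun K => Tm.app K _) (.appLeft _)⟩
  | appRight hv _ ih =>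
    cases hX with
    | app hM hN =>
      obtain ⟨V, hV, hXV, hs⟩ := exists_interval_value hv hM
      obtain ⟨M', hM', hs'⟩ := ih hN hn hC
      exact ⟨_, .app hXV hM', ((hs _).lift (fun K => Tm.app K _) (.appLeft _)).trans
        (hs'.lift (Tm.app V) (.appRight hV))⟩
  | ite N P _ ih =>
    cases hX with
    | ite hM hN hP =>
      obtain ⟨M', hM', hs⟩ := ih hM hn hC
      exact ⟨_, .ite hM' hN hP, hs.lift (fun G => Tm.ite G _ _) (.ite _ _)⟩
  | prim f hf args i hv hs ih =>
    cases hX with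
    -- A collapsed application stems from a symbolic value, which cannot reduce.
    | collapse _ _ h _ =>
      obtain ⟨b, hb⟩ := exists_symRedexOn hs
      exact absurd hb ((symRedexSystem b).irreducible ((h i).isSymVal (.lit _)))
    | @prim _ _ _ _ _ args' hM =>
      obtain ⟨M', hM', hs'⟩ := ih (hM i) hn hC
      -- Arguments to the left of position `i` must be evaluated before the context rule applies;
      -- elsewhere `V` is a dummy.
      have hex : ∀ j, ∃ V, j < i → IsVal V ∧ intervalInterp.Inst (intervals t) (args j) V ∧
          ∀ σ, Steps (fun _ => IsVal) IntervalRedex (args' j, σ) (V, σ) := by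
        intro j
        by_cases hj : j < i
        · obtain ⟨V, h⟩ := exists_interval_value (hv j hj) (hM j)
          exact ⟨V, fun _ => h⟩
        · exact ⟨args' j, fun h => absurd h hj⟩
      choose V hV using hex
      refine ⟨_, .prim f hf fun j => ?_, (Steps.prim_prefix f hf args' V _ i i.2.le
        fun j hj => ⟨(hV j hj).1, (hV j hj).2.2 _⟩).trans (Steps.prim f hf _ i (fun j hj => ?_)
        (M' := M') ?_)⟩
      · by_cases hj : j = i
        · subst hj; simpa using hM'
        · simp only [Function.update_of_ne hj]
          split_ifs with hji
          · exact (hV j hji).2.1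
          · exact hM j
      · have hj' : (j : ℕ) < i := hj
        simpa [hj'] using (hV j hj).1
      · simpa using hs'
  | score _ ih =>
    cases hX with
    | score hM =>
      obtain ⟨M', hM', hs⟩ := ih hM hn hC
      exact ⟨_, .score hM', hs.lift Tm.score .score⟩

/-- Nothing recorded is ever discarded, so assumptions on the final state of a path hold at all its
intermediate states. -/
theorem symState_mono {a : Ty} {X X' : Tm F SymLit [] a} {q q' : SymState F}
    (h : CtxClosure (fun _ => IsSymVal) SymRedex X q X' q') :
    q.numSamples ≤ q'.numSamples ∧ q.constraints ⊆ q'.constraints := by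
  obtain ⟨b, N, N', hr⟩ := h.exists_redex
  cases hr <;> simp

/-- If the constraints of a symbolic path hold on an interval trace, then the interval run on that
trace follows the path. -/
theorem IsSymPath.intervalEvaluates {P : Program F} {V : Tm F SymLit [] Ty.real}
    {q : SymState F} (h : IsSymPath P V q) {t : IntervalTrace} (hn : q.numSamples = t.length)
    (hC : ∀ C ∈ q.constraints, C.Holds (intervalInterp.eval (intervals t) C.term)) :
    IntervalEvaluates P t (intervalInterp.eval (intervals t) V) (intervalScore t q.scores) := by
  have key : ∀ c, Reduces (fun _ => IsSymVal) SymRedex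
      (P.mapLit SymLit.const, (⟨0, [], []⟩ : SymState F)) c → c.2.numSamples ≤ t.length →
      (∀ C ∈ c.2.constraints, C.Holds (intervalInterp.eval (intervals t) C.term)) →
      ∃ M, intervalInterp.Inst (intervals t) c.1 M ∧ Steps (fun _ => IsVal) IntervalRedex
        (P.mapLit Interval.point, (t, Interval.point 1))
        (M, (t.drop c.2.numSamples, intervalScore t c.2.scores)) := by
    intro c hc
    induction hc with
    | refl => exact fun _ _ => ⟨P.mapLit Interval.point, Sim.mapLit (g := SymLit.const)
      (h := Interval.point) (ℓ := fun x y => y = intervalInterp.litEval (intervals t) x)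
      (fun r => rfl) P, .refl⟩
    | tail _ hs ih =>
      intro hn hC
      obtain ⟨h1, h2⟩ := symState_mono hs
      obtain ⟨M, hM, hr⟩ := ih (h1.trans hn) fun C hC' => hC C (h2 hC')
      obtain ⟨M', hM', hr'⟩ := exists_interval_steps hs hM hn hC
      exact ⟨M', hM', hr.trans hr'⟩
  obtain ⟨M, hM, hr⟩ := key _ h.2 hn.le hC
  have := hr.trans (exists_interval_lit h.1 hM _).2
  simpa [hn, IntervalEvaluates, Reduces, Steps] using this

/-! ### Soundness of interval runs -/

theorem mem_point (r : ℝ) : r ∈ (Interval.point r).toSet := ⟨le_rfl, le_rfl⟩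

theorem mem_liftFun {n : ℕ} (f : (Fin n → ℝ) → ℝ) {B : Box n} {x : Fin n → ℝ}
    (hx : x ∈ B.toSet) : f x ∈ (liftFun f B).toSet :=
  ⟨iInf₂_le x hx, le_iSup₂ (f := fun x _ => (f x : EReal)) x hx⟩

theorem mem_mul {I J : Interval} {x y : ℝ} (hx : x ∈ I.toSet) (hy : y ∈ J.toSet) :
    x * y ∈ (I.mul J).toSet :=
  mem_liftFun (fun x : Fin 2 → ℝ => x 0 * x 1) (B := ![I, J]) (x := ![x, y])
    (fun i => by fin_cases i <;> assumption)

/-- The relation between interval terms and the concrete terms they contain. -/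
abbrev Contains {Γ : List Ty} {a : Ty} : Tm F Interval Γ a → Tm F ℝ Γ a → Prop :=
  Sim (fun I r => r ∈ I.toSet) (fun _ _ _ _ => False)

/-- The relation between states of interval runs and the states of concrete runs they contain. -/
def StateContains (τ : IntervalTrace × Interval) (σ : List unitInterval × ℝ≥0) : Prop :=
  List.Forall₂ (fun (I : UnitSubinterval) (r : unitInterval) => (r : ℝ) ∈ I.1.toSet) τ.1 σ.1 ∧
    (σ.2 : ℝ) ∈ τ.2.toSet

/-- An interval guard is decided only if its sign condition holds on the whole interval, so each
contained concrete run takes the same branch; interval lifting and interval multiplication contain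
all pointwise results. -/
theorem exists_concrete_step {a : Ty} {M M' : Tm F Interval [] a}
    {τ τ' : IntervalTrace × Interval}
    (h : CtxClosure (fun _ => IsVal) IntervalRedex M τ M' τ') {N : Tm F ℝ [] a}
    {σ : List unitInterval × ℝ≥0} (hN : Contains M N) (hσ : StateContains τ σ) :
    ∃ N' σ', CtxClosure (fun _ => IsVal) Redex N σ N' σ' ∧ Contains M' N' ∧
      StateContains τ' σ' := by
  induction h with
  | redex hr =>
    obtain ⟨s, w⟩ := σ
    cases hr with
    | beta K _ _ hV =>
      cases hN with
      | app hL hX =>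
        cases hL with
        | lam hL => exact ⟨_, _, .redex (.beta _ _ _ (hX.isVal hV)), hL.inst hX, hσ⟩
    | fix K _ _ hV =>
      cases hN with
      | app hL hX =>
        cases hL with
        | fix hL => exact ⟨_, _, .redex (.fix _ _ _ (hX.isVal hV)), hL.inst₂ hX (.fix hL), hσ⟩
    | sample I t w =>
      cases hN
      obtain ⟨hs, hw⟩ := hσ
      cases hs with
      | cons hI hs => exact ⟨_, _, .redex (.sample _ _ _), .lit hI, hs, hw⟩
    | prim f hf args B t w hB =>
      cases hN with
      | collapse _ _ _ h => exact h.elim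
      | @prim _ _ _ _ _ xs h =>
        have : ∀ i, ∃ r, r ∈ (B i).toSet ∧ xs i = lit r := fun i => by
          have hi := h i
          rw [hB i] at hi
          generalize xs i = x at hi
          cases hi with
          | lit hi => exact ⟨_, hi, rfl⟩
        choose r hr hr' using this
        exact ⟨_, _, .redex (.prim f hf _ r _ _ hr'), .lit (mem_liftFun f hr), hσ⟩
    | iteLeft _ _ t w hr =>
      cases hN with
      | ite hG hN hP =>
        cases hG with
        | lit hI =>
          exact ⟨_, _, .redex (.iteLeft _ _ _ _ (EReal.coe_le_coe_iff.1 (hI.2.trans hr))), hN, hσ⟩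
    | iteRight _ _ t w hr =>
      cases hN with
      | ite hG hN hP =>
        cases hG with
        | lit hI =>
          exact ⟨_, _, .redex (.iteRight _ _ _ _ (EReal.coe_lt_coe_iff.1 (hr.trans_le hI.1))),
            hP, hσ⟩
    | score t w hr =>
      cases hN with
      | score hG =>
        cases hG with
        | @lit _ _ r hI =>
          have h0 : 0 ≤ r := EReal.coe_le_coe_iff.1 (hr.trans hI.1)
          refine ⟨_, _, .redex (.score _ _ h0), .lit hI, hσ.1, ?_⟩
          simpa [h0] using mem_mul hσ.2 hI
  | appLeft K _ ih =>
    cases hN with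
    | app hM hN =>
      obtain ⟨N', σ', hs, hN', hσ'⟩ := ih hM hσ
      exact ⟨_, _, .appLeft _ hs, .app hN' hN, hσ'⟩
  | appRight hv _ ih =>
    cases hN with
    | app hM hN =>
      obtain ⟨N', σ', hs, hN', hσ'⟩ := ih hN hσ
      exact ⟨_, _, .appRight (hM.isVal hv) hs, .app hM hN', hσ'⟩
  | ite _ _ _ ih =>
    cases hN with
    | ite hM hN hP =>
      obtain ⟨N', σ', hs, hN', hσ'⟩ := ih hM hσ
      exact ⟨_, _, .ite _ _ hs, .ite hN' hN hP, hσ'⟩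
  | prim f hf args i hv _ ih =>
    cases hN with
    | collapse _ _ _ h => exact h.elim
    | @prim _ _ _ _ _ xs hM =>
      obtain ⟨N', σ', hs, hN', hσ'⟩ := ih (hM i) hσ
      refine ⟨_, _, .prim f hf xs i (fun j hj => (hM j).isVal (hv j hj)) hs,
        .prim f hf fun j => ?_, hσ'⟩
      by_cases hj : j = i
      · subst hj; simpa using hN'
      · simpa [hj] using hM j
  | score _ ih =>
    cases hN with
    | score hM =>
      obtain ⟨N', σ', hs, hN', hσ'⟩ := ih hM hσ
      exact ⟨_, _, .score hs, .score hN', hσ'⟩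

/-- The result of an interval run contains the results of the concrete runs on the traces in the
interval trace. -/
theorem IntervalEvaluates.exists_evaluates {P : Program F} {t : IntervalTrace} {I w : Interval}
    (h : IntervalEvaluates P t I w) {s : List unitInterval}
    (hs : List.Forall₂ (fun (I : UnitSubinterval) (r : unitInterval) => (r : ℝ) ∈ I.1.toSet) t s) :
    ∃ r v, Evaluates P s r v ∧ r ∈ I.toSet ∧ (v : ℝ) ∈ w.toSet := by
  have key : ∀ c, Reduces (fun _ => IsVal) IntervalRedex
      (P.mapLit Interval.point, (t, Interval.point 1)) c →
      ∃ N σ, Reduces (fun _ => IsVal) Redex (P, (s, 1)) (N, σ) ∧ Contains c.1 N ∧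
        StateContains c.2 σ := by
    intro c hc
    induction hc with
    | refl =>
      refine ⟨_, _, .refl, ?_, hs, mem_point 1⟩
      simpa using Sim.mapLit (g := Interval.point) (h := id)
        (ℓ := fun (I : Interval) r => r ∈ I.toSet) mem_point P
    | tail _ hs ih =>
      obtain ⟨N, σ, hr, hN, hσ⟩ := ih
      obtain ⟨N', σ', hs', hN', hσ'⟩ := exists_concrete_step hs hN hσ
      exact ⟨N', σ', hr.tail hs', hN', hσ'⟩
  obtain ⟨N, ⟨s', v⟩, hr, hN, hσ, hv⟩ := key _ h
  cases hσ
  cases hN with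
  | lit hI => exact ⟨_, v, hr, hI, hv⟩

/-! ### Symbolic values as functions on the unit cube -/

/-- The value of a symbolic value at a point. -/
noncomputable def realEval {n : ℕ} (x : Fin n → ℝ) {Γ : List Ty} {a : Ty} (W : Tm F SymLit Γ a) :
    ℝ :=
  realInterp.eval (List.ofFn x) W

/-- The interval value of a symbolic value on a box. -/
noncomputable def boxEval {n : ℕ} (B : Box n) {Γ : List Ty} {a : Ty} (W : Tm F SymLit Γ a) :
    Interval :=
  intervalInterp.eval (List.ofFn B) W

theorem realEval_prim {n m : ℕ} (x : Fin n → ℝ) {Γ : List Ty} (f : (Fin m → ℝ) → ℝ) (hf : f ∈ F m)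
    (args : Fin m → Tm F SymLit Γ Ty.real) :
    realEval x (prim f hf args) = f fun i => realEval x (args i) := rfl

theorem boxEval_prim {n m : ℕ} (B : Box n) {Γ : List Ty} (f : (Fin m → ℝ) → ℝ) (hf : f ∈ F m)
    (args : Fin m → Tm F SymLit Γ Ty.real) :
    boxEval B (prim f hf args) = liftFun f fun i => boxEval B (args i) := rfl

/-- A symbolic literal acts as a constant, a coordinate or the default value, uniformly in the
point. The negations in the last case allow it to be matched between the real and the interval
interpretation. -/
theorem litEval_ofFn {L : Type} (A : Interp L) {n : ℕ} (v : SymLit) :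
    (∃ r, v = .const r ∧ ∀ x : Fin n → L, A.litEval (List.ofFn x) v = A.const r) ∨
      (∃ i : Fin n, v = .sampleVar (i + 1) ∧ ∀ x : Fin n → L, A.litEval (List.ofFn x) v = x i) ∨
      ((∀ r, v ≠ .const r) ∧ (∀ i : Fin n, v ≠ .sampleVar (i + 1)) ∧
        ∀ x : Fin n → L, A.litEval (List.ofFn x) v = A.const 0) := by
  rcases v with r | j
  · exact .inl ⟨r, rfl, fun _ => rfl⟩
  · rcases j with - | j
    · exact .inr (.inr ⟨by simp, by simp, fun _ => rfl⟩)
    · by_cases hj : j < n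
      · exact .inr (.inl ⟨⟨j, hj⟩, rfl, fun x => by simp [Interp.litEval, Interp.env, hj]⟩)
      · refine .inr (.inr ⟨by simp, fun i hi => hj ?_, fun x => ?_⟩)
        · have : j = i := by simpa using hi
          exact this ▸ i.2
        · simp [Interp.litEval, Interp.env, hj]

theorem occurrences_le_prim {m : ℕ} {Γ : List Ty} {f : (Fin m → ℝ) → ℝ} {hf : f ∈ F m}
    {args : Fin m → Tm F SymLit Γ Ty.real} (i : Fin m) (j : ℕ) :
    occurrences j (args i) ≤ occurrences j (prim f hf args) := by
  rw [occurrences]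
  exact Finset.single_le_sum (f := fun i => occurrences j (args i)) (fun _ _ => Nat.zero_le _)
    (Finset.mem_univ i)

/-- In a single-use application of a primitive function, no variable is shared by arguments. -/
theorem eq_of_occurrences_ne_zero {m : ℕ} {Γ : List Ty} {f : (Fin m → ℝ) → ℝ} {hf : f ∈ F m}
    {args : Fin m → Tm F SymLit Γ Ty.real} {j : ℕ} (h : occurrences j (prim f hf args) ≤ 1)
    {i i' : Fin m} (hi : occurrences j (args i) ≠ 0) (hi' : occurrences j (args i') ≠ 0) :
    i = i' := by
  by_contra hne
  rw [occurrences] at h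
  have := Finset.sum_le_sum_of_subset (f := fun i => occurrences j (args i))
    (Finset.subset_univ {i, i'})
  rw [Finset.sum_pair hne] at this
  omega

theorem realEval_congr {n : ℕ} {x y : Fin n → ℝ} {Γ : List Ty} {a : Ty} (W : Tm F SymLit Γ a)
    (h : ∀ i : Fin n, occurrences (i + 1) W ≠ 0 → x i = y i) : realEval x W = realEval y W := by
  induction W with
  | lit v =>
    rcases litEval_ofFn realInterp (n := n) v with ⟨r, -, hv⟩ | ⟨i, rfl, hv⟩ | ⟨-, -, hv⟩
    · exact (hv x).trans (hv y).symm
    · exact (hv x).trans ((h i (by simp [occurrences])).trans (hv y).symm)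
    · exact (hv x).trans (hv y).symm
  | prim f hf args ih =>
    rw [realEval_prim, realEval_prim]
    refine congrArg f (funext fun i => ih i fun j hj => h j fun h0 => hj ?_)
    exact Nat.le_zero.1 (h0 ▸ occurrences_le_prim i _)
  | _ => rfl

/-- Every primitive function occurring in `W` is continuous on some box that contains the values
of its arguments on `S`. -/
def PiecewiseOn {n : ℕ} (S : Set (Fin n → ℝ)) :
    ∀ {Γ : List Ty} {a : Ty}, Tm F SymLit Γ a → Prop
  | _, _, Tm.prim (n := m) f _ args => (∀ i, PiecewiseOn S (args i)) ∧ ∃ C : Box m,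
      ContinuousOn f C.toSet ∧ ∀ x ∈ S, ∀ i, realEval x (args i) ∈ (C i).toSet
  | _, _, Tm.lit _ => True
  | _, _, Tm.var _ => True
  | _, _, Tm.lam _ => True
  | _, _, Tm.fix _ => True
  | _, _, Tm.app _ _ => True
  | _, _, Tm.ite _ _ _ => True
  | _, _, Tm.sample => True
  | _, _, Tm.score _ => True

theorem PiecewiseOn.continuousOn {n : ℕ} {S : Set (Fin n → ℝ)} {Γ : List Ty} {a : Ty}
    {W : Tm F SymLit Γ a} (h : PiecewiseOn S W) : ContinuousOn (fun x => realEval x W) S := by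
  induction W with
  | lit v =>
    rcases litEval_ofFn realInterp (n := n) v with ⟨r, -, hv⟩ | ⟨i, rfl, hv⟩ | ⟨-, -, hv⟩
    · exact continuousOn_const.congr fun x _ => hv x
    · exact (continuous_apply i).continuousOn.congr fun x _ => hv x
    · exact continuousOn_const.congr fun x _ => hv x
  | prim f hf args ih =>
    obtain ⟨h, C, hC, hSC⟩ := h
    exact hC.comp (continuousOn_pi.2 fun i => ih i (h i)) hSC
  | _ => exact continuousOn_const

/-! ### Exactness of interval evaluation on bounded boxes -/

/-- The bounded interval `[a, b]`. -/
noncomputable def Interval.icc (a b : ℝ) (h : a ≤ b) : Interval :=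
  ⟨a, b, EReal.coe_ne_top a, EReal.coe_ne_bot b, EReal.coe_le_coe_iff.2 h⟩

theorem Interval.toSet_icc {a b : ℝ} (h : a ≤ b) : (icc a b h).toSet = Set.Icc a b := by
  ext x
  simp [toSet, icc]

theorem Interval.toSet_point (a : ℝ) : (point a).toSet = {a} := by
  ext x
  simp only [toSet, point, Set.mem_ofPred_eq, EReal.coe_le_coe_iff, Set.mem_singleton_iff]
  exact ⟨fun h => le_antisymm h.2 h.1, fun h => ⟨h.ge, h.le⟩⟩

theorem toSet_liftFun {n : ℕ} {f : (Fin n → ℝ) → ℝ} {D : Box n} {c d : ℝ} (hcd : c ≤ d)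
    (h : f '' D.toSet = Set.Icc c d) : (liftFun f D).toSet = Set.Icc c d := by
  have hlo : (liftFun f D).lo = c := by
    refine le_antisymm ?_ (le_iInf₂ fun x hx => EReal.coe_le_coe_iff.2 ?_)
    · obtain ⟨x, hx, hxc⟩ := h.ge (Set.left_mem_Icc.2 hcd)
      exact hxc ▸ iInf₂_le x hx
    · exact (h.le (Set.mem_image_of_mem f hx)).1
  have hhi : (liftFun f D).hi = d := by
    refine le_antisymm (iSup₂_le fun x hx => EReal.coe_le_coe_iff.2 ?_) ?_
    · exact (h.le (Set.mem_image_of_mem f hx)).2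
    · obtain ⟨x, hx, hxd⟩ := h.ge (Set.right_mem_Icc.2 hcd)
      exact hxd ▸ le_iSup₂ (f := fun x _ => (f x : EReal)) x hx
  ext x
  simp [Interval.toSet, hlo, hhi]

/-- A bounded box is the order interval spanned by its corners. -/
theorem toSet_box_icc {n : ℕ} {a b : Fin n → ℝ} (h : a ≤ b) :
    Box.toSet (fun i => Interval.icc (a i) (b i) (h i)) = Set.Icc a b := by
  ext x
  simp only [Box.toSet, Interval.toSet_icc, Set.mem_ofPred_eq, Set.mem_Icc, Pi.le_def]
  exact forall_and

/-- A nonempty compact connected subset of the line is a bounded closed interval. -/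
theorem exists_image_eq_Icc {n : ℕ} {a b : Fin n → ℝ} (h : a ≤ b) {g : (Fin n → ℝ) → ℝ}
    (hg : ContinuousOn g (Set.Icc a b)) : ∃ c d, c ≤ d ∧ g '' Set.Icc a b = Set.Icc c d := by
  have hconn : IsConnected (g '' Set.Icc a b) :=
    ((convex_Icc a b).isConnected ⟨a, le_rfl, h⟩).image g hg
  have heq := eq_Icc_of_connected_compact hconn (isCompact_Icc.image_of_continuousOn hg)
  refine ⟨_, _, ?_, heq⟩
  exact Set.nonempty_Icc.1 (heq ▸ hconn.nonempty)

/-- Interval evaluation of single-use symbolic values is exact where they are piecewise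
continuous. -/
theorem toSet_boxEval {n : ℕ} {a b : Fin n → ℝ} (h : a ≤ b) {Γ : List Ty} {c : Ty}
    {W : Tm F SymLit Γ c} (hW : PiecewiseOn (Set.Icc a b) W) (h1 : ∀ j, occurrences j W ≤ 1) :
    (boxEval (fun i => Interval.icc (a i) (b i) (h i)) W).toSet =
      (fun x => realEval x W) '' Set.Icc a b := by
  have hne : (Set.Icc a b).Nonempty := ⟨a, le_rfl, h⟩
  induction W with
  | @lit Γ' v =>
    rcases litEval_ofFn intervalInterp (n := n) v with ⟨r, rfl, hv⟩ | ⟨i, rfl, hv⟩ | ⟨h1, h2, hv⟩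
    · exact (congrArg _ (hv fun i => Interval.icc (a i) (b i) (h i))).trans
        ((Interval.toSet_point r).trans (hne.image_const r).symm)
    · refine (congrArg _ (hv _)).trans ?_
      have hr : (fun x : Fin n → ℝ => realEval x
          (lit (SymLit.sampleVar (i + 1)) : Tm F SymLit Γ' Ty.real)) = fun x => x i := by
        funext x
        simp [realEval, Interp.eval, Interp.litEval, Interp.env]
      rw [Interval.toSet_icc, hr]
      refine Set.Subset.antisymm (fun y hy => ?_) ?_
      · refine ⟨Function.update a i y, ⟨fun j => ?_, fun j => ?_⟩, by simp⟩
        · by_cases hj : j = i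
          · subst hj; simpa using hy.1
          · simp [hj]
        · by_cases hj : j = i
          · subst hj; simpa using hy.2
          · simpa [hj] using h j
      · rintro _ ⟨x, hx, rfl⟩
        exact ⟨hx.1 i, hx.2 i⟩
    · rcases litEval_ofFn realInterp (n := n) v with ⟨r, rfl, -⟩ | ⟨i, rfl, -⟩ | ⟨-, -, hv'⟩
      · exact absurd rfl (h1 r)
      · exact absurd rfl (h2 i)
      · have hr : (fun x : Fin n → ℝ => realEval x (lit v : Tm F SymLit Γ' Ty.real)) =
            fun _ => 0 := funext fun x => hv' x
        rw [hr, hne.image_const]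
        exact (congrArg _ (hv _)).trans (Interval.toSet_point 0)
  | prim f hf args ih =>
    have hcont := hW.continuousOn
    obtain ⟨hW, -⟩ := hW
    have ih' := fun i => ih i (hW i) fun j => (occurrences_le_prim i j).trans (h1 j)
    -- By continuity the image is a compact interval, so recording only its infimum and supremum
    -- loses nothing.
    obtain ⟨lo, hi, hlh, heq⟩ := exists_image_eq_Icc h hcont
    rw [heq, boxEval_prim]
    refine toSet_liftFun hlh ?_
    rw [← heq]
    refine Set.Subset.antisymm ?_ ?_
    · rintro _ ⟨y, hy, rfl⟩
      have hy' : ∀ i, ∃ x ∈ Set.Icc a b, realEval x (args i) = y i := fun i =>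
        (ih' i).le (hy i)
      choose x hx hxy using hy'
      classical
      -- Each argument attains its prescribed value at a point of its own. Since no variable is
      -- shared, these points merge into one: coordinate `j` is taken from the point of the only
      -- argument that uses it.
      refine ⟨fun j => if hj : ∃ i, occurrences (j + 1) (args i) ≠ 0 then x hj.choose j else a j,
        ⟨fun j => ?_, fun j => ?_⟩, ?_⟩
      · dsimp only
        split_ifs with hj
        · exact (hx _).1 j
        · exact le_rfl
      · dsimp only
        split_ifs with hj
        · exact (hx _).2 j
        · exact h j
      · dsimp only
        rw [realEval_prim]
        refine congrArg f (funext fun i => (realEval_congr _ fun j hj => ?_).trans (hxy i))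
        have hex : ∃ i, occurrences ((j : ℕ) + 1) (args i) ≠ 0 := ⟨i, hj⟩
        rw [dif_pos hex, eq_of_occurrences_ne_zero (h1 _) hex.choose_spec hj]
    · rintro _ ⟨x, hx, rfl⟩
      exact ⟨fun i => realEval x (args i), fun i => (ih' i).ge ⟨x, hx, rfl⟩, rfl⟩
  | _ => exact (Interval.toSet_point 0).trans (hne.image_const 0).symm

/-! ### Single-use values as primitive functions of distinct coordinates -/

/-- A single-use symbolic value is, up to the choice of distinct variables, a primitive function
or a variable. -/
theorem exists_mem_withId (hF : F.Admissible) {n : ℕ} {Γ : List Ty} {a : Ty} (W : Tm F SymLit Γ a)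
    (h1 : ∀ j, occurrences j W ≤ 1) :
    ∃ (m : ℕ) (g : (Fin m → ℝ) → ℝ) (ι : Fin m → Fin n), g ∈ F.withId m ∧ ι.Injective ∧
      (∀ p, occurrences (ι p + 1) W ≠ 0) ∧ ∀ x : Fin n → ℝ, realEval x W = g fun p => x (ι p) := by
  have hconst : ∀ c : ℝ, (∀ x : Fin n → ℝ, realEval x W = c) →
      ∃ (m : ℕ) (g : (Fin m → ℝ) → ℝ) (ι : Fin m → Fin n), g ∈ F.withId m ∧ ι.Injective ∧
        (∀ p, occurrences (ι p + 1) W ≠ 0) ∧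
          ∀ x : Fin n → ℝ, realEval x W = g fun p => x (ι p) := fun c hc =>
    ⟨0, fun _ => c, Fin.elim0, .inl (hF.const_mem 0 c), fun p => p.elim0, fun p => p.elim0, hc⟩
  induction W with
  | lit v =>
    rcases litEval_ofFn realInterp (n := n) v with ⟨r, -, hv⟩ | ⟨i, rfl, hv⟩ | ⟨-, -, hv⟩
    · exact hconst r hv
    · exact ⟨1, fun x => x 0, fun _ => i, .inr ⟨rfl, 0, rfl⟩,
        fun _ _ _ => Subsingleton.elim _ _, by simp [occurrences], hv⟩
    · exact hconst _ hv
  | prim f hf args ih =>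
    have := fun i => ih i (fun j => (occurrences_le_prim i j).trans (h1 j)) fun c hc =>
      ⟨0, fun _ => c, Fin.elim0, .inl (hF.const_mem 0 c), fun p => p.elim0, fun p => p.elim0, hc⟩
    choose k g ι hg hι hocc hx using this
    -- The coordinates of the arguments are concatenated in the order used by `comp`. That every
    -- chosen coordinate occurs in its argument is carried through the induction because, with
    -- single use, it makes the concatenated choice injective.
    refine ⟨∑ i, k i, comp f k g, fun p => ι _ (finSigmaFinEquiv.symm p).2,
      .inl (hF.comp_mem _ f hf k g hg), fun p p' hp => ?_, fun p h0 => ?_, fun x => ?_⟩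
    · apply finSigmaFinEquiv.symm.injective
      dsimp only at hp
      generalize finSigmaFinEquiv.symm p = s at hp
      generalize finSigmaFinEquiv.symm p' = s' at hp
      obtain ⟨i, j⟩ := s
      obtain ⟨i', j'⟩ := s'
      have hij : ι i j = ι i' j' := hp
      obtain rfl := eq_of_occurrences_ne_zero (h1 _) (hocc i j) (hij ▸ hocc i' j')
      rw [hι i hij]
    · exact hocc _ (finSigmaFinEquiv.symm p).2 (Nat.le_zero.1 (h0 ▸ occurrences_le_prim _ _))
    · rw [realEval_prim, comp]
      refine congrArg f (funext fun i => ?_)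
      rw [hx]
      refine congrArg (g i) (funext fun j => ?_)
      dsimp only
      rw [Equiv.symm_apply_apply]
  | _ => exact hconst 0 fun _ => rfl

theorem intervalSeparable_of_mem_withId (hF : F.Admissible) {n : ℕ} {g : (Fin n → ℝ) → ℝ}
    (hg : g ∈ F.withId n) : IntervalSeparable g := by
  rcases hg with hg | ⟨rfl, j, rfl⟩
  · exact hF.intervalSeparable n g hg
  · intro J
    have h : Box.toSet (fun _ : Fin 1 => J) = (fun x : Fin 1 → ℝ => x j) ⁻¹' J.toSet := by
      ext x
      exact ⟨fun h => h j, fun h i => Subsingleton.elim j i ▸ h⟩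
    refine ⟨{fun _ => J}, Set.countable_singleton _, ?_, ?_⟩
    · simp [h]
    · simp [h]

open MeasureTheory Filter

/-! ### Grids -/

theorem div_le_succ_div (k i : ℕ) : (i : ℝ) / (k + 1) ≤ (i + 1) / (k + 1) := by
  gcongr
  linarith

/-- The `i`-th interval of the subdivision of `[0,1]` into `k + 1` intervals of equal length. -/
noncomputable def cell (k : ℕ) (i : Fin (k + 1)) : UnitSubinterval :=
  ⟨Interval.icc (i / (k + 1)) ((i + 1) / (k + 1)) (div_le_succ_div k i), by
    simp only [Interval.icc]
    constructor
    · exact_mod_cast (by positivity : (0 : ℝ) ≤ i / (k + 1))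
    · have : ((i : ℕ) : ℝ) + 1 ≤ k + 1 := by exact_mod_cast i.2
      exact_mod_cast (div_le_one (by positivity)).2 this⟩

theorem toSet_cell (k : ℕ) (i : Fin (k + 1)) :
    (cell k i).1.toSet = Set.Icc ((i : ℝ) / (k + 1)) ((i + 1) / (k + 1)) :=
  Interval.toSet_icc (div_le_succ_div k i)

/-- The index of a cell that contains a given point. -/
noncomputable def cellIndex (k : ℕ) (x : unitInterval) : Fin (k + 1) :=
  -- The minimum matters only at `x = 1`, which is put into the last cell.
  ⟨min ⌊(x : ℝ) * (k + 1)⌋₊ k, Nat.lt_succ_of_le (min_le_right _ _)⟩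

theorem mem_cell_cellIndex (k : ℕ) (x : unitInterval) :
    (x : ℝ) ∈ (cell k (cellIndex k x)).1.toSet := by
  have hk : (0 : ℝ) < k + 1 := by positivity
  have h0 : 0 ≤ (x : ℝ) * (k + 1) := mul_nonneg x.2.1 hk.le
  rw [toSet_cell, Set.mem_Icc, div_le_iff₀ hk, le_div_iff₀ hk]
  simp only [cellIndex]
  constructor
  · exact (Nat.cast_le.2 (min_le_left _ _)).trans (Nat.floor_le h0)
  · rcases le_total ⌊(x : ℝ) * (k + 1)⌋₊ k with h | h
    · rw [min_eq_left h]
      exact (Nat.lt_floor_add_one _).le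
    · rw [min_eq_right h]
      exact mul_le_of_le_one_left hk.le x.2.2

theorem measurable_cellIndex (k : ℕ) : Measurable (cellIndex k) := by
  have : Measurable fun x : unitInterval => min ⌊(x : ℝ) * (k + 1)⌋₊ k :=
    (Nat.measurable_floor.comp (measurable_subtype_coe.mul_const _)).min measurable_const
  refine measurable_to_countable' fun i => ?_
  convert this (measurableSet_singleton (i : ℕ)) using 1
  ext x
  simp [cellIndex, Fin.ext_iff]

/-- The cell of the grid on the unit cube that contains a given point. -/
noncomputable def cube {n : ℕ} (k : ℕ) (s : Fin n → unitInterval) : Box n :=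
  fun i => (cell k (cellIndex k (s i))).1

theorem eventually_cell_subset {x : unitInterval} {I : Interval} (hlo : I.lo < (x : ℝ))
    (hhi : ((x : ℝ) : EReal) < I.hi) :
    ∀ᶠ k in atTop, (cell k (cellIndex k x)).1.toSet ⊆ I.toSet := by
  have hI : ∀ᶠ y : ℝ in 𝓝 (x : ℝ), y ∈ I.toSet := by
    have h1 : ∀ᶠ y : ℝ in 𝓝 (x : ℝ), I.lo < y :=
      continuous_coe_real_ereal.continuousAt.eventually (lt_mem_nhds hlo)
    have h2 : ∀ᶠ y : ℝ in 𝓝 (x : ℝ), (y : EReal) < I.hi :=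
      continuous_coe_real_ereal.continuousAt.eventually (gt_mem_nhds hhi)
    filter_upwards [h1, h2] with y h1 h2 using ⟨h1.le, h2.le⟩
  obtain ⟨ε, hε, hb⟩ := Metric.eventually_nhds_iff.1 hI
  filter_upwards [(tendsto_one_div_add_atTop_nhds_zero_nat (𝕜 := ℝ)).eventually_lt_const hε]
    with k hk y hy
  refine hb ?_
  have hx := mem_cell_cellIndex k x
  rw [toSet_cell] at hx hy
  refine (Real.dist_le_of_mem_Icc hy hx).trans_lt ?_
  rwa [← sub_div, add_sub_cancel_left]

/-! ### Almost everywhere properties -/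

/-- Distinct coordinates of a uniform point are independent and uniform, so their joint law is
Lebesgue measure restricted to a cube. With repeated coordinates the image would lie in a diagonal,
and null sets could pull back to non-null ones. -/
theorem quasiMeasurePreserving_coe_comp {m n : ℕ} {ι : Fin m → Fin n} (hι : ι.Injective) :
    Measure.QuasiMeasurePreserving
      (fun (s : Fin n → unitInterval) (p : Fin m) => (s (ι p) : ℝ)) volume volume := by
  have hmeas : Measurable fun (s : Fin n → unitInterval) (p : Fin m) => (s (ι p) : ℝ) :=
    measurable_pi_lambda _ fun p => measurable_subtype_coe.comp (measurable_pi_apply _)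
  refine ⟨hmeas, ?_⟩
  have hpi : Measure.pi (fun _ : Fin m => (volume : Measure ℝ).restrict unitInterval) =
      Measure.map (fun (s : Fin n → unitInterval) (p : Fin m) => (s (ι p) : ℝ)) volume := by
    refine Measure.pi_eq fun A hA => ?_
    rw [Measure.map_apply hmeas (MeasurableSet.univ_pi hA)]
    classical
    -- The preimage of a rectangle is a cylinder; the sides outside the range of `ι` are full and
    -- contribute the factor `1`.
    let A' : Fin n → Set unitInterval := fun i =>
      if h : ∃ p, ι p = i then (↑) ⁻¹' A h.choose else Set.univ
    have hA' : ∀ p, A' (ι p) = (↑) ⁻¹' A p := fun p => by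
      have h : ∃ p', ι p' = ι p := ⟨p, rfl⟩
      simp only [A', dif_pos h, hι h.choose_spec]
    have hpre : (fun (s : Fin n → unitInterval) (p : Fin m) => (s (ι p) : ℝ)) ⁻¹' Set.univ.pi A =
        Set.univ.pi A' := by
      ext s
      simp only [Set.mem_preimage, Set.mem_univ_pi]
      refine ⟨fun h i => ?_, fun h p => by simpa [hA'] using h (ι p)⟩
      by_cases hi : ∃ p, ι p = i
      · obtain ⟨p, rfl⟩ := hi
        rw [hA']
        exact h p
      · simp only [A', dif_neg hi, Set.mem_univ]
    rw [hpre, volume_pi, Measure.pi_pi]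
    have h1 : ∀ i, i ∉ Set.range ι → volume (A' i) = 1 := fun i hi => by
      have hi : ¬ ∃ p, ι p = i := hi
      simp only [A', dif_neg hi, measure_univ]
    refine (Fintype.prod_of_injective ι hι _ _ h1 fun p => ?_).symm
    rw [hA']
    exact (unitInterval.measurePreserving_coe.measure_preimage (hA p).nullMeasurableSet).symm
  rw [← hpi, ← Measure.restrict_pi_pi]
  exact Measure.restrict_le_self.absolutelyContinuous

theorem ae_forall_notMem {n : ℕ} {E : Set ℝ} (hE : E.Countable) :
    ∀ᵐ s : Fin n → unitInterval, ∀ i, (s i : ℝ) ∉ E := by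
  refine ae_all_iff.2 fun i => ?_
  have h : ∀ᵐ x : unitInterval, (x : ℝ) ∉ E := by
    have : ((↑) ⁻¹' E : Set unitInterval).Countable :=
      hE.preimage Subtype.val_injective
    exact measure_eq_zero_iff_ae_notMem.1 (this.measure_zero volume)
  exact (measurePreserving_eval (fun _ : Fin n => (volume : Measure unitInterval))
    i).quasiMeasurePreserving.ae h

/-- Almost every point whose value lies in an interval has a neighbourhood with that property. -/
theorem ae_eventually_realEval_mem (hF : F.Admissible) {n : ℕ} {Γ : List Ty} {a : Ty}
    {W : Tm F SymLit Γ a} (h1 : ∀ j, occurrences j W ≤ 1) (J : Interval) :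
    ∀ᵐ s : Fin n → unitInterval, realEval (fun i => (s i : ℝ)) W ∈ J.toSet →
      ∀ᶠ k in atTop, ∀ y ∈ (cube k s).toSet, realEval y W ∈ J.toSet := by
  obtain ⟨m, g, ι, hg, hι, -, hW⟩ := exists_mem_withId hF (n := n) W h1
  obtain ⟨𝓑, h𝓑, hsub, hnull⟩ := intervalSeparable_of_mem_withId hF hg J
  -- All finite endpoints of sides of boxes; an infinite endpoint merely adds the harmless point
  -- `0`. A point of a box whose coordinates avoid `E` is interior to the box.
  let E : Set ℝ := ⋃ B ∈ 𝓑, ⋃ p, {(B p).lo.toReal, (B p).hi.toReal}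
  have hE : E.Countable := h𝓑.biUnion fun B _ => Set.countable_iUnion fun p =>
    (Set.toFinite _).countable
  filter_upwards [ae_forall_notMem hE, (quasiMeasurePreserving_coe_comp hι).ae
    (measure_eq_zero_iff_ae_notMem.1 hnull)] with s hsE hs hsJ
  rw [hW] at hsJ
  have hmem : (fun p => (s (ι p) : ℝ)) ∈ ⋃ B ∈ 𝓑, B.toSet := by
    by_contra h
    exact hs ⟨hsJ, h⟩
  simp only [Set.mem_iUnion] at hmem
  obtain ⟨B, hB, hsB⟩ := hmem
  have hBk : ∀ p, ∀ᶠ k in atTop, (cell k (cellIndex k (s (ι p)))).1.toSet ⊆ (B p).toSet := by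
    intro p
    have hE' : ∀ r ∈ ({(B p).lo.toReal, (B p).hi.toReal} : Set ℝ), (s (ι p) : ℝ) ≠ r := by
      rintro r hr rfl
      exact hsE (ι p) (Set.mem_biUnion hB (Set.mem_iUnion.2 ⟨p, hr⟩))
    refine eventually_cell_subset ((hsB p).1.lt_of_ne fun h => ?_)
      ((hsB p).2.lt_of_ne fun h => ?_)
    · exact hE' _ (.inl rfl) (by rw [h, EReal.toReal_coe])
    · exact hE' _ (.inr rfl) (by rw [← h, EReal.toReal_coe])
  filter_upwards [eventually_all.2 hBk] with k hk y hy
  rw [hW]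
  exact hsub (Set.mem_biUnion hB fun p => hk p (hy (ι p)))

/-- The tuple of argument values lies in some box of continuity of the primitive function. By
`ae_eventually_realEval_mem` each argument stays in its side of that box on small cells. There are
countably many boxes, so their exceptional sets can be united. -/
theorem ae_eventually_piecewiseOn (hF : F.Admissible) {n : ℕ} {Γ : List Ty} {a : Ty}
    {W : Tm F SymLit Γ a} (h1 : ∀ j, occurrences j W ≤ 1) :
    ∀ᵐ s : Fin n → unitInterval, ∀ᶠ k in atTop, PiecewiseOn (cube k s).toSet W := by
  induction W with
  | prim f hf args ih =>
    have h1' := fun i j => (occurrences_le_prim i j).trans (h1 j)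
    obtain ⟨𝓑, h𝓑, -, hcover, hcont⟩ := hF.boxwiseContinuous _ f hf
    have hbox := (ae_ball_iff h𝓑).2 fun B _ => ae_all_iff.2 fun i =>
      ae_eventually_realEval_mem hF (n := n) (h1' i) (B i)
    filter_upwards [ae_all_iff.2 fun i => ih i (h1' i), hbox] with s hs hbox
    have hx : (fun i => realEval (fun j => (s j : ℝ)) (args i)) ∈ ⋃ B ∈ 𝓑, B.toSet :=
      hcover ▸ Set.mem_univ _
    simp only [Set.mem_iUnion] at hx
    obtain ⟨C, hC, hxC⟩ := hx
    filter_upwards [eventually_all.2 hs, eventually_all.2 fun i => hbox C hC i (hxC i)]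
      with k hk hkC
    exact ⟨hk, C, hcont C hC, fun x hx i => hkC i x hx⟩
  | _ => exact .of_forall fun _ => .of_forall fun _ => trivial

/-- For almost every point whose value lies in an interval, interval evaluation on small cells
yields a subinterval. -/
theorem ae_eventually_boxEval_subset (hF : F.Admissible) {n : ℕ} {Γ : List Ty} {a : Ty}
    {W : Tm F SymLit Γ a} (h1 : ∀ j, occurrences j W ≤ 1) (J : Interval) :
    ∀ᵐ s : Fin n → unitInterval, realEval (fun i => (s i : ℝ)) W ∈ J.toSet →
      ∀ᶠ k in atTop, (boxEval (cube k s) W).toSet ⊆ J.toSet := by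
  filter_upwards [ae_eventually_realEval_mem hF (n := n) h1 J, ae_eventually_piecewiseOn hF h1]
    with s hs hs' hsJ
  filter_upwards [hs hsJ, hs'] with k hk hk'
  have hle : (fun i => ((cellIndex k (s i) : ℕ) : ℝ) / (k + 1)) ≤
      fun i => (((cellIndex k (s i) : ℕ) : ℝ) + 1) / (k + 1) := fun i =>
    div_le_succ_div k _
  have hbox : (cube k s).toSet = Set.Icc _ _ := toSet_box_icc hle
  rw [hbox] at hk hk'
  -- Exactness turns the statement about points of the cell into one about its interval evaluation.
  have := toSet_boxEval hle hk' h1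
  refine Set.Subset.trans this.le ?_
  rintro _ ⟨y, hy, rfl⟩
  exact hk y hy

/-! ### Convergence of the interval semantics along a path -/

theorem Interval.le_of_toSet_subset {I J : Interval} (h : I.toSet ⊆ J.toSet) :
    J.lo ≤ I.lo ∧ I.hi ≤ J.hi := by
  obtain ⟨z, hz⟩ := I.toSet_nonempty
  constructor
  · by_contra! hlt
    obtain ⟨y, hy, hy'⟩ := EReal.lt_iff_exists_real_btwn.1 hlt
    -- The point `y` alone might exceed `I.hi`; taking the minimum with a point of `I` prevents
    -- this.
    have hm : min y z ∈ I.toSet := ⟨by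
      rw [EReal.coe_strictMono.monotone.map_min]; exact le_min hy.le hz.1,
      (EReal.coe_le_coe_iff.2 (min_le_right y z)).trans hz.2⟩
    exact absurd ((h hm).1.trans (EReal.coe_le_coe_iff.2 (min_le_left y z))) (not_le.2 hy')
  · by_contra! hlt
    obtain ⟨y, hy, hy'⟩ := EReal.lt_iff_exists_real_btwn.1 hlt
    have hm : max y z ∈ I.toSet := ⟨hz.1.trans (EReal.coe_le_coe_iff.2 (le_max_right y z)), by
      rw [EReal.coe_strictMono.monotone.map_max]; exact max_le hy'.le hz.2⟩
    exact absurd ((EReal.coe_le_coe_iff.2 (le_max_left y z)).trans (h hm).2) (not_le.2 hy)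

/-- The interval `[b, ∞]`. -/
noncomputable def Interval.ici (b : ℝ) : Interval :=
  ⟨b, ⊤, EReal.coe_ne_top b, top_ne_bot, le_top⟩

/-- The interval `[-∞, b]`. -/
noncomputable def Interval.iic (b : ℝ) : Interval :=
  ⟨⊥, b, bot_ne_top, EReal.coe_ne_bot b, bot_le⟩

/-- Separability for a closed half-line gives the bound `b` itself, with no loss. Nonstrict
constraints that hold with equality on a set of positive measure require this. -/
theorem ae_eventually_le_lo (hF : F.Admissible) {n : ℕ} {Γ : List Ty} {a : Ty}
    {W : Tm F SymLit Γ a} (h1 : ∀ j, occurrences j W ≤ 1) (b : ℝ) :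
    ∀ᵐ s : Fin n → unitInterval, b ≤ realEval (fun i => (s i : ℝ)) W →
      ∀ᶠ k in atTop, (b : EReal) ≤ (boxEval (cube k s) W).lo := by
  filter_upwards [ae_eventually_boxEval_subset hF (n := n) h1 (.ici b)] with s hs hb
  exact (hs ⟨EReal.coe_le_coe_iff.2 hb, le_top⟩).mono fun k hk =>
    (Interval.le_of_toSet_subset hk).1

theorem ae_eventually_hi_le (hF : F.Admissible) {n : ℕ} {Γ : List Ty} {a : Ty}
    {W : Tm F SymLit Γ a} (h1 : ∀ j, occurrences j W ≤ 1) (b : ℝ) :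
    ∀ᵐ s : Fin n → unitInterval, realEval (fun i => (s i : ℝ)) W ≤ b →
      ∀ᶠ k in atTop, (boxEval (cube k s) W).hi ≤ b := by
  filter_upwards [ae_eventually_boxEval_subset hF (n := n) h1 (.iic b)] with s hs hb
  exact (hs ⟨bot_le, EReal.coe_le_coe_iff.2 hb⟩).mono fun k hk =>
    (Interval.le_of_toSet_subset hk).2

/-- The bounds for all rational `b` hold simultaneously outside a null set, and they squeeze both
endpoints. -/
theorem ae_tendsto_boxEval (hF : F.Admissible) {n : ℕ} {Γ : List Ty} {a : Ty}
    {W : Tm F SymLit Γ a} (h1 : ∀ j, occurrences j W ≤ 1) :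
    ∀ᵐ s : Fin n → unitInterval,
      Tendsto (fun k => (boxEval (cube k s) W).lo) atTop
        (𝓝 (realEval (fun i => (s i : ℝ)) W : ℝ)) ∧
      Tendsto (fun k => (boxEval (cube k s) W).hi) atTop
        (𝓝 (realEval (fun i => (s i : ℝ)) W : ℝ)) := by
  filter_upwards [ae_all_iff.2 fun q : ℚ => ae_eventually_le_lo hF (n := n) h1 q,
    ae_all_iff.2 fun q : ℚ => ae_eventually_hi_le hF (n := n) h1 q] with s hlo hhi
  have hlo' : ∀ c < ((realEval (fun i => (s i : ℝ)) W : ℝ) : EReal),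
      ∀ᶠ k in atTop, c < (boxEval (cube k s) W).lo := fun c hc => by
    obtain ⟨q, hcq, hq⟩ := EReal.lt_iff_exists_rat_btwn.1 hc
    exact (hlo q (EReal.coe_lt_coe_iff.1 hq).le).mono fun k hk => hcq.trans_le hk
  have hhi' : ∀ c > ((realEval (fun i => (s i : ℝ)) W : ℝ) : EReal),
      ∀ᶠ k in atTop, (boxEval (cube k s) W).hi < c := fun c hc => by
    obtain ⟨q, hq, hcq⟩ := EReal.lt_iff_exists_rat_btwn.1 hc
    exact (hhi q (EReal.coe_lt_coe_iff.1 hq).le).mono fun k hk => hk.trans_lt hcq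
  exact ⟨tendsto_order.2 ⟨hlo', fun c hc => (hhi' c hc).mono fun k hk =>
      (boxEval (cube k s) W).lo_le_hi.trans_lt hk⟩,
    tendsto_order.2 ⟨fun c hc => (hlo' c hc).mono fun k hk =>
      hk.trans_le (boxEval (cube k s) W).lo_le_hi, hhi'⟩⟩

/-- Nonstrict constraints follow from the lossless half-line bounds, strict ones from convergence of
the endpoints. -/
theorem ae_eventually_holds (hF : F.Admissible) {n : ℕ} {C : SymConstraint F}
    (h1 : ∀ j, occurrences j C.term ≤ 1) :
    ∀ᵐ s : Fin n → unitInterval, C.Holds (.point (realEval (fun i => (s i : ℝ)) C.term)) →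
      ∀ᶠ k in atTop, C.Holds (boxEval (cube k s) C.term) := by
  obtain ⟨W, r, b⟩ := C
  filter_upwards [ae_tendsto_boxEval hF (n := n) h1, ae_eventually_le_lo hF (n := n) h1 b,
    ae_eventually_hi_le hF (n := n) h1 b] with s ht hlo hhi hs
  cases r with
  | le => exact hhi (EReal.coe_le_coe_iff.1 hs)
  | lt => exact ht.2.eventually_lt_const hs
  | ge => exact hlo (EReal.coe_le_coe_iff.1 hs)
  | gt => exact ht.1.eventually_const_lt hs

/-- The product of the lower bounds of the scores on a box. -/
noncomputable def lowerScore {n : ℕ} (B : Box n) (Ξ : List (Tm F SymLit [] Ty.real)) : ℝ≥0 :=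
  (Ξ.map fun W => (boxEval B W).lo.toReal.toNNReal).prod

theorem le_lo_mul {I J : Interval} {x y : ℝ≥0} (hx : ((x : ℝ) : EReal) ≤ I.lo)
    (hy : ((y : ℝ) : EReal) ≤ J.lo) : (((x * y : ℝ≥0) : ℝ) : EReal) ≤ (I.mul J).lo := by
  refine le_iInf₂ fun z hz => EReal.coe_le_coe_iff.2 ?_
  have h0 : (x : ℝ) ≤ z 0 := EReal.coe_le_coe_iff.1 (hx.trans (hz 0).1)
  have h1 : (y : ℝ) ≤ z 1 := EReal.coe_le_coe_iff.1 (hy.trans (hz 1).1)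
  push_cast
  exact mul_le_mul h0 h1 y.2 (x.2.trans h0)

/-- Nonnegativity makes lower bounds multiply. An inequality suffices, so infinite upper endpoints
need no attention. -/
theorem lowerScore_le {n : ℕ} {B : Box n} {t : IntervalTrace} (ht : intervals t = List.ofFn B)
    {Ξ : List (Tm F SymLit [] Ty.real)} (h : ∀ W ∈ Ξ, 0 ≤ (boxEval B W).lo) :
    ((lowerScore B Ξ : ℝ) : EReal) ≤ (intervalScore t Ξ).lo := by
  induction Ξ with
  | nil => exact le_rfl
  | cons W Ξ ih =>
    obtain ⟨hW, hΞ⟩ := List.forall_mem_cons.1 h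
    have hs : intervalScore t (W :: Ξ) = (intervalScore t Ξ).mul (boxEval B W) := by
      rw [boxEval, ← ht]
      rfl
    have hl : lowerScore B (W :: Ξ) =
        lowerScore B Ξ * (boxEval B W).lo.toReal.toNNReal := by
      simp [lowerScore, mul_comm]
    rw [hs, hl]
    refine le_lo_mul (ih hΞ) ?_
    rw [Real.coe_toNNReal _ (EReal.toReal_nonneg hW),
      EReal.coe_toReal (boxEval B W).lo_ne_top ((EReal.bot_lt_zero.trans_le hW).ne')]

theorem ae_tendsto_lowerScore (hF : F.Admissible) {n : ℕ} {Ξ : List (Tm F SymLit [] Ty.real)}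
    (h1 : ∀ W ∈ Ξ, ∀ j, occurrences j W ≤ 1) :
    ∀ᵐ s : Fin n → unitInterval, Tendsto (fun k => lowerScore (cube k s) Ξ) atTop
      (𝓝 (Ξ.map fun W => (realEval (fun i => (s i : ℝ)) W).toNNReal).prod) := by
  have hae := (ae_ball_iff Ξ.finite_toSet.countable).2 fun W hW =>
    ae_tendsto_boxEval hF (n := n) (h1 W hW)
  filter_upwards [hae] with s hs
  refine tendsto_list_prod Ξ fun W hW => ?_
  have := (EReal.tendsto_toReal (EReal.coe_ne_top _) (EReal.coe_ne_bot _)).comp (hs W hW).1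
  exact (continuous_real_toNNReal.tendsto _).comp this

/-! ### The lower bounds obtained from grids -/

/-- The interval trace whose entries are the cells with given indices. -/
noncomputable def gridTrace (k : ℕ) {n : ℕ} (c : Fin n → Fin (k + 1)) : IntervalTrace :=
  List.ofFn fun i => cell k (c i)

/-- The terminating interval traces of length at most `k` that consist of cells. -/
def gridFamily (P : Program F) (k : ℕ) : Set IntervalTrace :=
  {t | (∃ n ≤ k, ∃ c : Fin n → Fin (k + 1), gridTrace k c = t) ∧ ∃ I w, IntervalEvaluates P t I w}

theorem finite_gridFamily (P : Program F) (k : ℕ) : (gridFamily P k).Finite := by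
  refine ((Set.finite_Iic k).biUnion (t := fun n => Set.range (gridTrace k (n := n)))
    fun n _ => Set.finite_range _).subset ?_
  rintro t ⟨⟨n, hn, c, rfl⟩, -⟩
  exact Set.mem_biUnion hn ⟨c, rfl⟩

theorem almostDisjoint_cell {k : ℕ} {i j : Fin (k + 1)} (h : i ≠ j) :
    Interval.AlmostDisjoint (cell k i).1 (cell k j).1 := by
  have key : ∀ {i j : Fin (k + 1)}, i < j → (cell k i).1.hi ≤ (cell k j).1.lo := fun {i j} hij => by
    refine EReal.coe_le_coe_iff.2 ?_
    have : ((i : ℕ) : ℝ) + 1 ≤ (j : ℕ) := by exact_mod_cast hij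
    gcongr
  rcases lt_or_gt_of_ne h with h | h
  · exact .inl (key h)
  · exact .inr (key h)

theorem CompatibleTraces.symm {t u : IntervalTrace} (h : CompatibleTraces t u) :
    CompatibleTraces u t := by
  obtain ⟨i, ht, hu, h⟩ := h
  exact ⟨i, hu, ht, h.symm⟩

/-- Two traces of cells that differ at a common position are almost disjoint there. Otherwise one is
a prefix of the other, and since both terminate they coincide. -/
theorem compatible_gridFamily (P : Program F) (k : ℕ) : Compatible (gridFamily P k) := by
  have key : ∀ {n m : ℕ} (c : Fin n → Fin (k + 1)) (d : Fin m → Fin (k + 1)), n ≤ m →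
      (∃ I w, IntervalEvaluates P (gridTrace k c) I w) →
      (∃ I w, IntervalEvaluates P (gridTrace k d) I w) → gridTrace k c ≠ gridTrace k d →
      CompatibleTraces (gridTrace k c) (gridTrace k d) := by
    intro n m c d hnm hc hd hne
    by_cases h : ∃ i : Fin n, c i ≠ d (Fin.castLE hnm i)
    · obtain ⟨i, hi⟩ := h
      refine ⟨i, by simp [gridTrace], by simpa [gridTrace] using i.2.trans_le hnm, ?_⟩
      simp only [gridTrace, List.getElem_ofFn]
      exact almostDisjoint_cell hi
    · push Not at h
      obtain ⟨l, rfl⟩ := Nat.exists_eq_add_of_le hnm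
      have hd' : gridTrace k d = gridTrace k c ++ gridTrace k fun j => d (Fin.natAdd n j) := by
        simp only [gridTrace, List.ofFn_add]
        congr 1
        exact congrArg _ (funext fun i => by rw [h i])
      obtain ⟨I, w, hc⟩ := hc
      obtain ⟨J, v, hd⟩ := hd
      rw [hd'] at hd hne
      have := hc.eq_nil_of_append hd
      rw [this, List.append_nil] at hne
      exact absurd rfl hne
  rintro t ⟨⟨n, -, c, rfl⟩, ht⟩ u ⟨⟨m, -, d, rfl⟩, hu⟩ hne
  rcases le_total n m with hnm | hnm
  · exact key c d hnm ht hu hne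
  · exact (key d c hnm hu ht hne.symm).symm

/-! ### Step functions on the space of traces -/

open Classical in
/-- The guaranteed weight of an interval trace. -/
noncomputable def guaranteedWeight (P : Program F) (U : Set ℝ) (t : IntervalTrace) : ℝ≥0∞ :=
  (intervalWeight P t).lo.toENNReal * (if (intervalValue P t).toSet ⊆ U then 1 else 0)

/-- The default weight `[0, ∞]` has lower endpoint `0`, so traces without a terminating run may be
added to the sum freely. -/
theorem guaranteedWeight_eq_zero {P : Program F} {U : Set ℝ} {t : IntervalTrace}
    (h : ¬ ∃ I w, IntervalEvaluates P t I w) : guaranteedWeight P U t = 0 := by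
  have h' : ¬ ∃ w I, IntervalEvaluates P t I w := fun ⟨w, I, h'⟩ => h ⟨I, w, h'⟩
  simp [guaranteedWeight, intervalWeight, dif_neg h', Interval.nonneg]

/-- The step function on traces given by the guaranteed weights of the cells. -/
noncomputable def gridFun (P : Program F) (U : Set ℝ) (k : ℕ) (s : Trace) : ℝ≥0∞ :=
  if s.1 ≤ k then guaranteedWeight P U (gridTrace k fun i => cellIndex k (s.2 i)) else 0

theorem measurable_sigma {β : Type*} [MeasurableSpace β] {g : Trace → β}
    (h : ∀ n, Measurable fun s : Fin n → unitInterval => g ⟨n, s⟩) : Measurable g :=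
  fun _ hU => MeasurableSpace.measurableSet_iInf.2 fun n => h n hU

/-- On each cube the function factors through the finite set of index tuples. Fatou's lemma needs
this measurability. -/
theorem measurable_gridFun (P : Program F) (U : Set ℝ) (k : ℕ) : Measurable (gridFun P U k) := by
  refine measurable_sigma fun n => ?_
  have hc : Measurable fun (s : Fin n → unitInterval) i => cellIndex k (s i) :=
    measurable_pi_lambda _ fun i => (measurable_cellIndex k).comp (measurable_pi_apply i)
  exact (measurable_of_finite fun c : Fin n → Fin (k + 1) =>
    if n ≤ k then guaranteedWeight P U (gridTrace k c) else 0).comp hc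

theorem measurableEmbedding_sigmaMk (n : ℕ) :
    MeasurableEmbedding (Sigma.mk (β := fun n => Fin n → unitInterval) n) where
  injective := sigma_mk_injective
  measurable := fun _ hU => MeasurableSpace.measurableSet_iInf.1 hU n
  measurableSet_image' := fun {U} hU => MeasurableSpace.measurableSet_iInf.2 fun m => by
    change MeasurableSet (Sigma.mk m ⁻¹' (Sigma.mk (β := fun n => Fin n → unitInterval) n '' U))
    by_cases h : n = m
    · subst h
      rwa [Set.preimage_image_eq _ sigma_mk_injective]
    · convert MeasurableSet.empty
      ext s
      simp only [Set.mem_preimage, Set.mem_image, Set.mem_empty_iff_false, iff_false]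
      rintro ⟨x, -, hx⟩
      exact h (congrArg Sigma.fst hx)

theorem lintegral_traceMeasure (g : Trace → ℝ≥0∞) :
    ∫⁻ s, g s ∂traceMeasure = ∑' n, ∫⁻ s : Fin n → unitInterval, g ⟨n, s⟩ := by
  rw [traceMeasure, lintegral_sum_measure]
  exact tsum_congr fun n => (measurableEmbedding_sigmaMk n).lintegral_map g

/-- The points with index `i` contain the open cell and lie in the closed one, and these have the
same length. -/
theorem volume_cellIndex_preimage (k : ℕ) (i : Fin (k + 1)) :
    volume (cellIndex k ⁻¹' {i}) = ENNReal.ofReal ((i + 1) / (k + 1) - i / (k + 1)) := by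
  have hk : (0 : ℝ) < k + 1 := by positivity
  rw [unitInterval.volume_apply]
  refine le_antisymm ?_ ?_
  · rw [← Real.volume_Icc]
    refine measure_mono ?_
    rintro _ ⟨x, rfl, rfl⟩
    exact toSet_cell k _ ▸ mem_cell_cellIndex k x
  · rw [← Real.volume_Ioo]
    refine measure_mono fun y hy => ?_
    have h1 : (i : ℝ) < y * (k + 1) := (div_lt_iff₀ hk).1 hy.1
    have h2 : y * (k + 1) < (i : ℝ) + 1 := (lt_div_iff₀ hk).1 hy.2
    have hi : ((i : ℕ) : ℝ) + 1 ≤ k + 1 := by exact_mod_cast i.2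
    have hy0 : 0 ≤ y := (div_nonneg (Nat.cast_nonneg _) hk.le).trans hy.1.le
    have hy1 : y ≤ 1 := hy.2.le.trans ((div_le_one hk).2 hi)
    refine ⟨⟨y, hy0, hy1⟩, Fin.ext ?_, rfl⟩
    have hfl : ⌊y * (k + 1)⌋₊ = (i : ℕ) :=
      (Nat.floor_eq_iff (mul_nonneg hy0 hk.le)).2 ⟨h1.le, h2⟩
    simp only [cellIndex, hfl]
    exact min_eq_left (Nat.lt_succ_iff.1 i.2)

theorem traceVolume_gridTrace (k : ℕ) {n : ℕ} (c : Fin n → Fin (k + 1)) :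
    traceVolume (gridTrace k c) =
      ∏ i, ENNReal.ofReal (((c i : ℕ) + 1) / (k + 1) - (c i : ℕ) / (k + 1)) := by
  rw [traceVolume, gridTrace, List.map_ofFn, List.prod_ofFn]
  refine Finset.prod_congr rfl fun i _ => ?_
  exact EReal.toENNReal_of_ne_top (EReal.coe_ne_top _)

theorem lintegral_cellIndex (k n : ℕ) (G : (Fin n → Fin (k + 1)) → ℝ≥0∞) :
    ∫⁻ s : Fin n → unitInterval, G (fun i => cellIndex k (s i)) =
      ∑ c, traceVolume (gridTrace k c) * G c := by
  have hc : Measurable fun (s : Fin n → unitInterval) i => cellIndex k (s i) :=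
    measurable_pi_lambda _ fun i => (measurable_cellIndex k).comp (measurable_pi_apply i)
  rw [← lintegral_map (f := G) (measurable_of_finite G) hc, lintegral_fintype]
  refine Finset.sum_congr rfl fun c _ => ?_
  rw [mul_comm, traceVolume_gridTrace, Measure.map_apply hc (measurableSet_singleton c)]
  have hpre : (fun (s : Fin n → unitInterval) i => cellIndex k (s i)) ⁻¹' {c} =
      Set.univ.pi fun i => cellIndex k ⁻¹' {c i} := by
    ext s
    simp [funext_iff]
  rw [hpre, volume_pi, Measure.pi_pi]
  simp only [volume_cellIndex_preimage]

theorem cell_injective (k : ℕ) : (cell k).Injective := by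
  intro i j h
  have h' : ((i : ℝ) / (k + 1) : ℝ) = (j : ℝ) / (k + 1) :=
    EReal.coe_eq_coe_iff.1 (congrArg (fun I : UnitSubinterval => I.1.lo) h)
  have hk : (k + 1 : ℝ) ≠ 0 := by positivity
  rw [div_left_inj' hk] at h'
  exact Fin.ext (by exact_mod_cast h')

/-- In each dimension the points with a given index tuple form a set whose measure is the volume of
the grid box, so the sum of volume times guaranteed weight is the integral of the step function. -/
theorem lowerBound_gridFamily (P : Program F) (k : ℕ) (U : Set ℝ) :
    lowerBound P (gridFamily P k) U = ∫⁻ s, gridFun P U k s ∂traceMeasure := by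
  let Φ : (Σ n, Fin n → Fin (k + 1)) → IntervalTrace := fun x => gridTrace k x.2
  have hΦ : Φ.Injective := by
    rintro ⟨n, c⟩ ⟨m, d⟩ h
    obtain rfl : n = m := by simpa [Φ, gridTrace] using congrArg List.length h
    have := List.ofFn_injective h
    exact congrArg _ (funext fun i => cell_injective k (congrFun this i))
  let φ : IntervalTrace → ℝ≥0∞ := fun t => traceVolume t * guaranteedWeight P U t
  have h1 : lowerBound P (gridFamily P k) U = ∑' t, (gridFamily P k).indicator φ t := by
    rw [← tsum_subtype, lowerBound]
    exact tsum_congr fun t => mul_assoc _ _ _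
  -- The sum over interval traces becomes one over index tuples; that `Φ` reaches the whole support
  -- is the second goal.
  rw [h1, ← hΦ.tsum_eq, ENNReal.tsum_sigma', lintegral_traceMeasure]
  · refine tsum_congr fun n => ?_
    rw [tsum_fintype]
    refine Eq.trans (Finset.sum_congr rfl fun c _ => ?_) (lintegral_cellIndex k n fun c =>
      if n ≤ k then guaranteedWeight P U (gridTrace k c) else 0).symm
    by_cases hex : ∃ I w, IntervalEvaluates P (gridTrace k c) I w
    · by_cases hn : n ≤ k
      · have : Φ ⟨n, c⟩ ∈ gridFamily P k := ⟨⟨n, hn, c, rfl⟩, hex⟩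
        rw [Set.indicator_of_mem this, if_pos hn]
      · rw [if_neg hn, mul_zero, Set.indicator_of_notMem]
        rintro ⟨⟨m, hm, d, hd⟩, -⟩
        obtain rfl : m = n := by simpa [Φ, gridTrace] using congrArg List.length hd
        exact hn hm
    · rw [guaranteedWeight_eq_zero hex, ite_self, mul_zero, Set.indicator_of_notMem]
      exact fun h => hex h.2
  · intro t ht
    obtain ⟨⟨n, -, c, rfl⟩, -⟩ := Set.mem_of_indicator_ne_zero ht
    exact ⟨⟨n, c⟩, rfl⟩

/-- Every trace lies in its own grid box, so its concrete run is contained in the interval run on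
that box. -/
theorem gridFun_le (P : Program F) (U : Set ℝ) (k : ℕ) (s : Trace) :
    gridFun P U k s ≤ (valuePreimage P U).indicator (fun s => (weight P s : ℝ≥0∞)) s := by
  obtain ⟨n, s⟩ := s
  rw [gridFun]
  split_ifs with hn
  swap
  · exact zero_le
  by_cases hex : ∃ I w, IntervalEvaluates P (gridTrace k fun i => cellIndex k (s i)) I w
  swap
  · rw [guaranteedWeight_eq_zero hex]; exact zero_le
  obtain ⟨I, w, h⟩ := hex
  rw [guaranteedWeight, intervalWeight_eq h, intervalValue_eq h]
  split_ifs with hU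
  swap
  · rw [mul_zero]; exact zero_le
  obtain ⟨r, v, hr, hI, hv⟩ := h.exists_evaluates (s := Trace.toList ⟨n, s⟩) (by
    rw [List.forall₂_iff_get]
    refine ⟨by simp [gridTrace, Trace.toList], fun i h1 h2 => ?_⟩
    simpa [gridTrace, Trace.toList] using mem_cell_cellIndex k _)
  have hmem : (⟨n, s⟩ : Trace) ∈ valuePreimage P U := ⟨r, v, hr, hU hI⟩
  rw [Set.indicator_of_mem hmem, weight_eq hr, mul_one]
  refine (EReal.toENNReal_le_toENNReal hv.1).trans_eq ?_
  simp

/-- The symbolic path followed by a trace depends on the trace, so the exceptional null sets of all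
paths are removed beforehand; countability of the paths permits this. -/
theorem ae_le_liminf_gridFun (hF : F.Admissible) {P : Program F} (hP : SingleUse P)
    (U : Interval) :
    ∀ᵐ s ∂traceMeasure, (valuePreimage P U.toSet).indicator (fun s => (weight P s : ℝ≥0∞)) s ≤
      liminf (fun k => gridFun P U.toSet k s) atTop := by
  rw [traceMeasure, Measure.ae_sum_iff]
  intro n
  rw [(measurableEmbedding_sigmaMk n).ae_map_iff]
  have hval := (ae_ball_iff (countable_isSymPath P)).2 fun p hp =>
    ae_eventually_boxEval_subset hF (n := n) (fun j => (hP p.1 p.2 hp j).1) U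
  have hcon := (ae_ball_iff (countable_isSymPath P)).2 fun p hp =>
    (ae_ball_iff (List.finite_toSet p.2.constraints).countable).2 fun C hC =>
      ae_eventually_holds hF (n := n) fun j => (hP p.1 p.2 hp j).2.1 C hC
  have hnon := (ae_ball_iff (countable_isSymPath P)).2 fun p hp =>
    (ae_ball_iff (List.finite_toSet p.2.scores).countable).2 fun W hW =>
      ae_eventually_le_lo hF (n := n) (fun j => (hP p.1 p.2 hp j).2.2 W hW) 0
  have hsco := (ae_ball_iff (countable_isSymPath P)).2 fun p hp =>
    ae_tendsto_lowerScore hF (n := n) fun W hW j => (hP p.1 p.2 hp j).2.2 W hW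
  filter_upwards [hval, hcon, hnon, hsco] with s hval hcon hnon hsco
  by_cases hs : (⟨n, s⟩ : Trace) ∈ valuePreimage P U.toSet
  swap
  · rw [Set.indicator_of_notMem hs]; exact zero_le
  rw [Set.indicator_of_mem hs]
  obtain ⟨r, w, hev, hr⟩ := hs
  rw [weight_eq hev]
  obtain ⟨V, q, hpath, hlen, rfl, rfl, hC, hW⟩ := hev.exists_isSymPath
  have hrt : realTrace (Trace.toList ⟨n, s⟩) = List.ofFn fun i => (s i : ℝ) := by
    simp only [realTrace, Trace.toList, List.map_ofFn]
    rfl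
  simp only [scoreProd, hrt] at hC hW hr ⊢
  -- The lower scores along the path converge to the weight, so it is enough that eventually they
  -- bound the step function from below.
  refine (((ENNReal.continuous_coe.tendsto _).comp (hsco (V, q) hpath)).liminf_eq.ge).trans
    (liminf_le_liminf ?_)
  -- For large `k` the trace is short enough, the value interval lies in `U`, and all constraints
  -- and score bounds hold on the cell; each list is finite.
  filter_upwards [hval (V, q) hpath hr, eventually_ge_atTop n,
    (Set.Finite.eventually_all (List.finite_toSet q.constraints)).2 fun C hC' =>
      hcon (V, q) hpath C hC' (hC C hC'),
    (Set.Finite.eventually_all (List.finite_toSet q.scores)).2 fun W hW' =>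
      hnon (V, q) hpath W hW' (hW W hW')] with k hval hk hcon hnon
  have hint : intervals (gridTrace k fun i => cellIndex k (s i)) = List.ofFn (cube k s) := by
    simp only [intervals, gridTrace, List.map_ofFn]
    rfl
  have hev : IntervalEvaluates P (gridTrace k fun i => cellIndex k (s i)) (boxEval (cube k s) V)
      (intervalScore (gridTrace k fun i => cellIndex k (s i)) q.scores) := by
    have := hpath.intervalEvaluates (t := gridTrace k fun i => cellIndex k (s i))
      (by simpa [gridTrace, Trace.toList] using hlen) (by rw [hint]; exact hcon)
    rwa [hint] at this
  have hsub : (intervalValue P (gridTrace k fun i => cellIndex k (s i))).toSet ⊆ U.toSet := by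
    rwa [intervalValue_eq hev]
  rw [gridFun, if_pos hk, guaranteedWeight, if_pos hsub, mul_one, intervalWeight_eq hev]
  refine Eq.trans_le ?_ (EReal.toENNReal_le_toENNReal (lowerScore_le hint hnon))
  simp

end SPCF

/-! ### Conclusion by Fatou's lemma -/

theorem mainTheorem8 (F : SPCF.PrimSet) (hF : F.Admissible) (P : SPCF.Program F)
    (hAST : SPCF.AlmostSurelyTerminating P) (hP : SPCF.SingleUse P) (I : SPCF.Interval) :
    ∃ T : ℕ → Set SPCF.IntervalTrace,
      (∀ n, (T n).Finite ∧ SPCF.Compatible (T n)) ∧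
      Filter.Tendsto (fun n => SPCF.lowerBound P (T n) I.toSet) Filter.atTop
        (𝓝 (SPCF.denotation P I.toSet)) := by
  refine ⟨SPCF.gridFamily P, fun n => ⟨SPCF.finite_gridFamily P n, SPCF.compatible_gridFamily P n⟩,
    ?_⟩
  simp only [SPCF.lowerBound_gridFamily, SPCF.denotation]
  refine tendsto_of_le_liminf_of_limsup_le ?_ ?_
  -- Fatou's lemma is applied to the step functions, so measurability of the weight itself plays no
  -- role.
  · exact (MeasureTheory.lintegral_mono_ae (SPCF.ae_le_liminf_gridFun hF hP I)).trans
      (MeasureTheory.lintegral_liminf_le fun k => SPCF.measurable_gridFun P _ k)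
  · exact Filter.limsup_le_of_le (h := .of_forall fun k =>
      MeasureTheory.lintegral_mono (SPCF.gridFun_le P _ k))
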